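/- Conventions. A differential operator of order $n$ is $\mathcal P=\sum_{i=0}^{n}q_i(t)\frac{d^i}{dt^i}$ with $q_i\in\mathbb C(t)$, $q_n\neq 0$. A point $a\in\mathbb C$ is non-singular for $\mathcal P$ if no $q_i/q_n$ has a pole at $a$. $\mathcal P$ is Fuchsian if all its singular points in $\mathbb P^1$ are regular. For a non-singular point $b$ let $V_b(\mathcal P)$ be the space of germs at $b$ of holomorphic solutions of $\mathcal Py=0$; the monodromy group $Mon(\mathcal P)\subset \mathrm{GL}(V_b(\mathcal P))$ consists of the automorphisms given by analytic continuation along loops based at $b$ that avoid the singular points. For $n=4$, $\mathcal P$ is called symplectic if it is Fuchsian and, in some basis of $V_b(\mathcal P)$, $Mon(\mathcal P)$ is a Zariski-dense subgroup of $\mathrm{Sp}(4,\mathbb Z)$ (i.e. it is contained in $\mathrm{Sp}(4,\mathbb Z)$ and is Zariski-dense in $\mathrm{Sp}(4,\mathbb C)$); $Mon(\mathcal P)$ is called arithmetic if in some basis of $V_b(\mathcal P)$ it is a subgroup of finite index in $\mathrm{Sp}(4,\mathbb Z)$. Statement. Let $\mathcal P,\mathcal Q$ be differential operators of order $4$ and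 let $b\in\mathbb C$ be a non-singular point of both. Let $f$ be holomorphic near $b$ with $f(b)\neq 0$ and such that $f^n\in\mathbb C(t)$ for some integer $n\geq 1$. Assume that $\mathcal P$ is symplectic and that $\mathcal Q$ is the shift of $\mathcal P$ by $f$, i.e. $\mathcal Q(fy)=0$ for every $y\in V_b(\mathcal P)$. 1. If $f^2\in\mathbb C(t)$, then $\mathcal Q$ is symplectic, and $Mon(\mathcal P)$ is arithmetic if and only if $Mon(\mathcal Q)$ is arithmetic. 2. If $\mathcal Q$ is symplectic and, for some bases of $V_b(\mathcal P)$ and $V_b(\mathcal Q)$ used to regard both monodromy groups as subgroups of $\mathrm{GL}(4,\mathbb C)$, the intersection $Mon(\mathcal P)\cap Mon(\mathcal Q)$ is a Zariski-dense subgroup of $\mathrm{Sp}(4,\mathbb Z)$, then $f^2\in\mathbb C(t)$. -/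

import Mathlib

open Filter Topology

noncomputable section

namespace FuchsianShift

/-! ### Linear differential operators with rational coefficients -/

/-- A linear differential operator `∑_{i ≤ n} q_i(t) (d/dt)^i` of order exactly `n`,
with coefficients in `ℂ(t)`. -/
structure DiffOp (n : ℕ) where
  /-- The coefficient `q_i` of `(d/dt)^i`. -/
  coeff : Fin (n + 1) → RatFunc ℂ
  /-- The leading coefficient is not zero. -/
  lead_ne_zero : coeff (Fin.last n) ≠ 0

/-- The value of a rational function at a point (only used away from its poles). -/
def ratVal (r : RatFunc ℂ) (t : ℂ) : ℂ := r.eval (RingHom.id ℂ) t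

namespace DiffOp

variable {n : ℕ} (P : DiffOp n)

/-- The normalized coefficient `q_i / q_n`, for `i < n`. -/
def normCoeff (i : Fin n) : RatFunc ℂ := P.coeff i.castSucc / P.coeff (Fin.last n)

/-- The finite point `a` is a non-singular point: no `q_i / q_n` has a pole at `a`. -/
def Nonsingular (a : ℂ) : Prop := ∀ i : Fin n, (P.normCoeff i).denom.eval a ≠ 0

/-- All singular points, including infinity, are regular singular points: at every finite point
`q_i / q_n` has a pole of order at most `n - i`, and at infinity it vanishes to order at least
`n - i`. -/
def IsFuchsian : Prop :=
  (∀ (a : ℂ) (i : Fin n), (P.normCoeff i).denom.rootMultiplicity a ≤ n - (i : ℕ)) ∧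
  ∀ i : Fin n, P.normCoeff i = 0 ∨ (P.normCoeff i).intDegree ≤ (i : ℤ) - (n : ℤ)

/-- `q_n(t)⁻¹ (P y)(t) = y⁽ⁿ⁾(t) + ∑_{i < n} (q_i/q_n)(t) y⁽ⁱ⁾(t)`. -/
def normApply (y : ℂ → ℂ) (t : ℂ) : ℂ :=
  iteratedDeriv n y t + ∑ i : Fin n, ratVal (P.normCoeff i) t * iteratedDeriv (i : ℕ) y t

/-- The space of germs at `b` of holomorphic solutions of `P y = 0`. -/
def solutions (b : ℂ) : Submodule ℂ (Germ (𝓝 b) ℂ) where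
  carrier := {y | ∃ g : ℂ → ℂ, y = (g : Germ (𝓝 b) ℂ) ∧ AnalyticAt ℂ g b ∧
    ∀ᶠ t in 𝓝 b, P.normApply g t = 0}
  zero_mem' := by
    refine ⟨fun _ => 0, rfl, analyticAt_const, Eventually.of_forall fun t => ?_⟩
    simp [normApply]
  add_mem' := by
    rintro _ _ ⟨g, rfl, hg, hg0⟩ ⟨h, rfl, hh, hh0⟩
    refine ⟨g + h, rfl, hg.add hh, ?_⟩
    filter_upwards [hg0, hh0, hg.eventually_analyticAt, hh.eventually_analyticAt]
      with t h1 h2 h3 h4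
    have key : ∀ k : ℕ, iteratedDeriv k (g + h) t = iteratedDeriv k g t + iteratedDeriv k h t :=
      fun k => iteratedDeriv_add h3.contDiffAt h4.contDiffAt
    simp only [normApply, key, mul_add, Finset.sum_add_distrib] at h1 h2 ⊢
    linear_combination h1 + h2
  smul_mem' := by
    rintro c _ ⟨g, rfl, hg, hg0⟩
    refine ⟨c • g, rfl, hg.const_smul, ?_⟩
    filter_upwards [hg0, hg.eventually_analyticAt] with t h1 h3
    have key : ∀ k : ℕ, iteratedDeriv k (c • g) t = c * iteratedDeriv k g t :=
      fun k => by
        rw [iteratedDeriv_const_smul h3.contDiffAt c, smul_eq_mul]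
    have : P.normApply (c • g) t = c * P.normApply g t := by
      simp only [normApply, key, mul_add, Finset.mul_sum]
      congr 1
      exact Finset.sum_congr rfl fun i _ => by ring
    rw [this, h1, mul_zero]

end DiffOp

/-! ### Analytic continuation and the monodromy group -/

/-- The germ `z` at `c` is the analytic continuation along the path `γ` of the germ `y` at `b`:
there are functions `g s`, analytic at `γ s`, which for nearby parameters have the same germs,
and which start with `y` and end with `z`. -/
def ContinuesAlong {b c : ℂ} (γ : Path b c) (y : Germ (𝓝 b) ℂ) (z : Germ (𝓝 c) ℂ) : Prop :=
  ∃ g : unitInterval → ℂ → ℂ,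
    (∀ s, AnalyticAt ℂ (g s) (γ s)) ∧
    (∀ s, ∀ᶠ s' in 𝓝 s, g s' =ᶠ[𝓝 (γ s')] g s) ∧
    y = (g 0 : Germ (𝓝 b) ℂ) ∧ z = (g 1 : Germ (𝓝 c) ℂ)

theorem ContinuesAlong.refl {b : ℂ} {y : Germ (𝓝 b) ℂ} {g : ℂ → ℂ}
    (hy : y = (g : Germ (𝓝 b) ℂ)) (hg : AnalyticAt ℂ g b) :
    ContinuesAlong (Path.refl b) y y :=
  ⟨fun _ => g, fun _ => hg, fun _ => Eventually.of_forall fun _ => EventuallyEq.rfl, hy, hy⟩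

theorem ContinuesAlong.symm {b c : ℂ} {γ : Path b c} {y : Germ (𝓝 b) ℂ} {z : Germ (𝓝 c) ℂ}
    (h : ContinuesAlong γ y z) : ContinuesAlong γ.symm z y := by
  obtain ⟨g, h1, h2, h3, h4⟩ := h
  refine ⟨fun s => g (unitInterval.symm s), fun s => h1 _, fun s => ?_, ?_, ?_⟩
  · exact (unitInterval.continuous_symm.tendsto s).eventually (h2 (unitInterval.symm s))
  · simpa using h4
  · simpa using h3

theorem ContinuesAlong.trans {a b c : ℂ} {γ : Path a b} {δ : Path b c} {x : Germ (𝓝 a) ℂ}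
    {y : Germ (𝓝 b) ℂ} {z : Germ (𝓝 c) ℂ}
    (h : ContinuesAlong γ x y) (k : ContinuesAlong δ y z) :
    ContinuesAlong (γ.trans δ) x z := by
  obtain ⟨g, g1, g2, g3, g4⟩ := h
  obtain ⟨h, h1, h2, h3, h4⟩ := k
  let u : unitInterval → unitInterval := fun s => Set.projIcc 0 1 zero_le_one (2 * (s : ℝ))
  let v : unitInterval → unitInterval := fun s => Set.projIcc 0 1 zero_le_one (2 * (s : ℝ) - 1)
  have hu : Continuous u := continuous_projIcc.comp (by fun_prop)
  have hv : Continuous v := continuous_projIcc.comp (by fun_prop)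
  have e1 : ∀ s : unitInterval, (s : ℝ) ≤ 1 / 2 → (γ.trans δ) s = γ (u s) := by
    intro s hs
    simp only [Path.trans, Path.coe_mk_mk, Function.comp, if_pos hs]; rfl
  have e2 : ∀ s : unitInterval, ¬ (s : ℝ) ≤ 1 / 2 → (γ.trans δ) s = δ (v s) := by
    intro s hs
    simp only [Path.trans, Path.coe_mk_mk, Function.comp, if_neg hs]; rfl
  have hgh : g 1 =ᶠ[𝓝 b] h 0 := Germ.coe_eq.1 (g4.symm.trans h3)
  let F : unitInterval → ℂ → ℂ := fun s => if (s : ℝ) ≤ 1 / 2 then g (u s) else h (v s)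
  have f1 : ∀ s : unitInterval, (s : ℝ) ≤ 1 / 2 → F s = g (u s) := fun s hs => if_pos hs
  have f2 : ∀ s : unitInterval, ¬ (s : ℝ) ≤ 1 / 2 → F s = h (v s) := fun s hs => if_neg hs
  refine ⟨F, fun s => ?_, fun s => ?_, ?_, ?_⟩
  · by_cases hs : (s : ℝ) ≤ 1 / 2
    · rw [e1 s hs, f1 s hs]; exact g1 _
    · rw [e2 s hs, f2 s hs]; exact h1 _
  · have G := (hu.tendsto s).eventually (g2 (u s))
    have H := (hv.tendsto s).eventually (h2 (v s))
    rcases lt_trichotomy (s : ℝ) (1 / 2) with hs | hs | hs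
    · filter_upwards [G, continuous_subtype_val.continuousAt.eventually (gt_mem_nhds hs)]
        with s' a1 a2
      rw [e1 s' a2.le, f1 s' a2.le, f1 s hs.le]
      exact a1
    · have hu1 : u s = 1 := by
        apply Subtype.ext
        simp [u, hs, Set.projIcc]
      have hv0 : v s = 0 := by
        apply Subtype.ext
        simp [v, hs, Set.projIcc]
      have hc : Tendsto (γ.trans δ) (𝓝 s) (𝓝 b) := by
        have := (γ.trans δ).continuous.tendsto s
        rwa [e1 s hs.le, hu1, γ.target] at this
      filter_upwards [G, H, hc.eventually hgh.eventually_nhds] with s' a1 a2 a3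
      rw [f1 s hs.le, hu1]
      rw [hu1] at a1
      rw [hv0] at a2
      by_cases hs' : (s' : ℝ) ≤ 1 / 2
      · rw [e1 s' hs', f1 s' hs']; exact a1
      · have a3' : g 1 =ᶠ[𝓝 ((γ.trans δ) s')] h 0 := a3
        rw [e2 s' hs'] at a3' ⊢
        rw [f2 s' hs']
        exact a2.trans a3'.symm
    · filter_upwards [H, continuous_subtype_val.continuousAt.eventually (lt_mem_nhds hs)]
        with s' a1 a2
      rw [e2 s' (not_le.2 a2), f2 s' (not_le.2 a2), f2 s (not_le.2 hs)]
      exact a1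
  · have : u 0 = 0 := Subtype.ext (by simp [u, Set.projIcc])
    rw [f1 0 (by simp), this, g3]
  · have : v 1 = 1 := Subtype.ext (by norm_num [v, Set.projIcc])
    rw [f2 1 (by norm_num), this, h4]

/-- The monodromy group of `P` at the non-singular base point `b`: all linear automorphisms `M` of
the space of local solutions at `b` that are given by analytic continuation along one loop based
at `b` in the complement of the singular points of `P`. (Loops may be taken in `ℂ`: a loop through
the point at infinity of `ℙ¹`, when that point is not singular, is homotopic to one avoiding it.) -/
def DiffOp.monodromyGroup {n : ℕ} (P : DiffOp n) {b : ℂ} (hb : P.Nonsingular b) :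
    Subgroup (LinearMap.GeneralLinearGroup ℂ (P.solutions b)) where
  carrier := {M | ∃ γ : Path b b, (∀ s, P.Nonsingular (γ s)) ∧
    ∀ y : P.solutions b, ContinuesAlong γ (y : Germ (𝓝 b) ℂ) (M.1 y : Germ (𝓝 b) ℂ)}
  one_mem' := by
    refine ⟨Path.refl b, fun _ => hb, ?_⟩
    rintro ⟨y, g, hy, hg, hg0⟩
    exact ContinuesAlong.refl hy hg
  mul_mem' := by
    rintro M N ⟨γ, hγ, hM⟩ ⟨δ, hδ, hN⟩
    refine ⟨δ.trans γ, fun s => ?_, fun y => (hN y).trans (hM _)⟩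
    have : (δ.trans γ) s ∈ Set.range δ ∪ Set.range γ := by
      rw [← Path.trans_range]; exact ⟨s, rfl⟩
    rcases this with ⟨s', h⟩ | ⟨s', h⟩
    · rw [← h]; exact hδ s'
    · rw [← h]; exact hγ s'
  inv_mem' := by
    rintro M ⟨γ, hγ, hM⟩
    refine ⟨γ.symm, fun s => hγ _, fun y => ?_⟩
    have := (hM ((M⁻¹ : LinearMap.GeneralLinearGroup ℂ (P.solutions b)).1 y)).symm
    have e : M.1 ((M⁻¹ : LinearMap.GeneralLinearGroup ℂ (P.solutions b)).1 y) = y := by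
      rw [← Module.End.mul_apply, Units.mul_inv, Module.End.one_apply]
    rw [e] at this
    exact this

/-! ### Symplectic groups and Zariski density -/

/-- `GL(4, ℂ)`, with rows and columns indexed by `Fin 2 ⊕ Fin 2`. -/
abbrev GL4 : Type := (Matrix (Fin 2 ⊕ Fin 2) (Fin 2 ⊕ Fin 2) ℂ)ˣ

/-- `Sp(4, ℤ)` as a subgroup of `GL(4, ℂ)`. -/
def Sp4Z : Subgroup GL4 :=
  (((Int.castRingHom ℂ).mapMatrix.toMonoidHom.comp
    (Matrix.symplecticGroup (Fin 2) ℤ).subtype).toHomUnits).range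

/-- `G` is a Zariski-dense subgroup of `Sp(4, ℤ)`: it is contained in `Sp(4, ℤ)`, and every
polynomial in the matrix entries that vanishes on `G` vanishes on `Sp(4, ℂ)`, the Zariski closure
of `Sp(4, ℤ)`. -/
def IsZariskiDenseInSp4Z (G : Subgroup GL4) : Prop :=
  G ≤ Sp4Z ∧
  ∀ p : MvPolynomial ((Fin 2 ⊕ Fin 2) × (Fin 2 ⊕ Fin 2)) ℂ,
    (∀ g ∈ G, MvPolynomial.eval (fun ij => g.1 ij.1 ij.2) p = 0) →
      ∀ A ∈ Matrix.symplecticGroup (Fin 2) ℂ, MvPolynomial.eval (fun ij => A ij.1 ij.2) p = 0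

/-- `G` is an arithmetic subgroup of `Sp(4, ℤ)`: it is contained in `Sp(4, ℤ)`, with finite
index. -/
def IsArithmeticInSp4Z (G : Subgroup GL4) : Prop :=
  G ≤ Sp4Z ∧ G.IsFiniteRelIndex Sp4Z

/-! ### Symplectic and arithmetic operators, shifts -/

namespace DiffOp

/-- The monodromy group of an operator of order four, as a group of matrices, in the basis `e` of
the space of solutions at `b`. -/
def monodromyMatrices (P : DiffOp 4) {b : ℂ} (hb : P.Nonsingular b)
    (e : Module.Basis (Fin 2 ⊕ Fin 2) ℂ (P.solutions b)) : Subgroup GL4 :=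
  (P.monodromyGroup hb).map (Units.map (LinearMap.toMatrixAlgEquiv e).toMulEquiv.toMonoidHom)

/-- `P` is symplectic: it is Fuchsian, and its monodromy group is conjugate to a Zariski-dense
subgroup of `Sp(4, ℤ)`. -/
def IsSymplectic (P : DiffOp 4) {b : ℂ} (hb : P.Nonsingular b) : Prop :=
  P.IsFuchsian ∧ ∃ e : Module.Basis (Fin 2 ⊕ Fin 2) ℂ (P.solutions b),
    IsZariskiDenseInSp4Z (P.monodromyMatrices hb e)

/-- The monodromy group of `P` is arithmetic: it is conjugate to a subgroup of finite index in
`Sp(4, ℤ)`. -/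
def HasArithmeticMonodromy (P : DiffOp 4) {b : ℂ} (hb : P.Nonsingular b) : Prop :=
  ∃ e : Module.Basis (Fin 2 ⊕ Fin 2) ℂ (P.solutions b),
    IsArithmeticInSp4Z (P.monodromyMatrices hb e)

/-- `Q` is the shift of `P` by (the multivalued function with the germ at `b` of) `f`: for every
local solution `y` of `P y = 0` the product `z = f y` satisfies `Q z = 0`. As `Q` has the same
order as `P`, it is determined up to multiplication by a rational function from the left. -/
def IsShift {n : ℕ} (P Q : DiffOp n) (b : ℂ) (f : ℂ → ℂ) : Prop :=
  ∀ y ∈ P.solutions b, (f : Germ (𝓝 b) ℂ) * y ∈ Q.solutions b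

end DiffOp

/-- The germ at `b` of `f` is that of a rational function. -/
def IsRationalAt (b : ℂ) (f : ℂ → ℂ) : Prop :=
  ∃ r : RatFunc ℂ, ∀ᶠ t in 𝓝 b, f t = ratVal r t

end FuchsianShift

end

/-! Multiplication by `f` embeds the solutions of `P` at `b` into those of `Q`; the first space has
dimension 4 and the second at most 4, so it is an isomorphism. As a power of `f` is rational, `f'/f
= ∑ α a / (t - a)` with finitely many simple poles. Hence `f` is multiplied by a constant `χ` along
every loop avoiding these poles, and the monodromy of `Q` along the loop is `χ` times that of `P`,
transported by `f` (`IsMonodromyAlong.exists_shift`). A loop used for one operator may run through a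
singular point of the other or through a point of `A`; `exists_continuesAlong_avoiding` moves it
away without changing the result of continuation.

If `f ^ 2` is rational, then `χ = ±1`, and in corresponding bases the two monodromy groups agree up
to signs. Finite index passes from one to the other because adjoining `-1` changes an index by a
factor of at most 2. Density passes because `Sp(4, ℂ)` is irreducible: if `p` vanishes on one group,
then `p(A) p(-A)` vanishes on the other, hence on `Sp(4, ℂ)`, hence one factor does. That `Q` is
Fuchsian is read off its coefficients, which come from those of `P` by the Leibniz rule with `u =
1/f`: the quotient `u⁽ᵐ⁾/u` has poles of order at most `m` and vanishes at infinity to order at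
least `m`.

For the converse, the symplectic form of `Q` written in the basis for `P` is a nonzero matrix `K`
with `χ² M K Mᵀ = K` for the monodromy `M` of `P` along a loop, and determinants give `χ⁴ = 1`. For
a nonzero entry `κ` of `K`, the same entry `x` of `M K Mᵀ` satisfies `(x - κ)(x + κ) = 0` on the
monodromy group of `P`, hence on `Sp(4, ℂ)`. By irreducibility one factor vanishes there, and the
identity matrix rules out the second. So `x = κ`, and `χ² = 1` for every loop. A small circle around
`a` has `χ = exp (2 π i α a)`, so all `2 α a` are integers and `f ^ 2` is a constant times `∏ (t -
a) ^ (2 α a)`.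

Irreducibility (`symplecticIdeal_isPrime`) holds because any two symplectic matrices lie on a
polynomial curve inside the group, and one-variable polynomials form a domain. -/

noncomputable section

namespace FuchsianShift

/-! ### Irreducibility of the complex symplectic group -/

section Symplectic

open Matrix Polynomial

/-- `A` is the value at `1` of a polynomial curve in `Sp(4, ℂ)` which starts at the identity. -/
def JoinedToOne (A : Matrix (Fin 2 ⊕ Fin 2) (Fin 2 ⊕ Fin 2) ℂ) : Prop :=
  ∃ C : Matrix (Fin 2 ⊕ Fin 2) (Fin 2 ⊕ Fin 2) ℂ[X],
    (∀ t, (evalRingHom t).mapMatrix C ∈ symplecticGroup (Fin 2) ℂ) ∧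
    (evalRingHom 0).mapMatrix C = 1 ∧ (evalRingHom 1).mapMatrix C = A

namespace JoinedToOne

theorem mul {A B : Matrix (Fin 2 ⊕ Fin 2) (Fin 2 ⊕ Fin 2) ℂ} (hA : JoinedToOne A)
    (hB : JoinedToOne B) : JoinedToOne (A * B) := by
  obtain ⟨C, h1, h2, h3⟩ := hA
  obtain ⟨D, k1, k2, k3⟩ := hB
  refine ⟨C * D, fun t => ?_, ?_, ?_⟩
  · rw [map_mul]; exact mul_mem (h1 t) (k1 t)
  · rw [map_mul, h2, k2, one_mul]
  · rw [map_mul, h3, k3]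

theorem upper {B : Matrix (Fin 2) (Fin 2) ℂ} (hB : Bᵀ = B) :
    JoinedToOne (fromBlocks 1 B 0 1) := by
  have key : ∀ t : ℂ, (evalRingHom t).mapMatrix (fromBlocks 1 ((X : ℂ[X]) • B.map C) 0 1) =
      fromBlocks 1 (t • B) 0 1 := by
    intro t
    simp only [RingHom.mapMatrix_apply, fromBlocks_map]
    congr 1
    · simp
    · ext i j; simp; exact mul_comm _ _
    · ext i j; simp
    · simp
  refine ⟨fromBlocks 1 ((X : ℂ[X]) • B.map C) 0 1, fun t => ?_, ?_, ?_⟩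
  · rw [key, SymplecticGroup.fromBlocks_mem_iff]
    simp [hB]
  · rw [key]; simp
  · rw [key]; simp

theorem lower {B : Matrix (Fin 2) (Fin 2) ℂ} (hB : Bᵀ = B) :
    JoinedToOne (fromBlocks 1 0 B 1) := by
  have key : ∀ t : ℂ, (evalRingHom t).mapMatrix (fromBlocks 1 0 ((X : ℂ[X]) • B.map C) 1) =
      fromBlocks 1 0 (t • B) 1 := by
    intro t
    simp only [RingHom.mapMatrix_apply, fromBlocks_map]
    congr 1
    · simp
    · ext i j; simp
    · ext i j; simp; exact mul_comm _ _
    · simp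
  refine ⟨fromBlocks 1 0 ((X : ℂ[X]) • B.map C) 1, fun t => ?_, ?_, ?_⟩
  · rw [key, SymplecticGroup.fromBlocks_mem_iff]
    simp [hB]
  · rw [key]; simp
  · rw [key]; simp

/-- The usual Weyl element trick: with `T = S⁻¹`, the first three unipotent factors multiply to the
block matrix `(0, S; -T, 0)`, the last three to `(0, -1; 1, 0)`. -/
theorem diag_of_symm {S T : Matrix (Fin 2) (Fin 2) ℂ} (hS : Sᵀ = S) (hT : Tᵀ = T)
    (h : S * T = 1) : JoinedToOne (fromBlocks S 0 0 T) := by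
  have h' : T * S = 1 := mul_eq_one_comm.1 h
  have hS' : (-S)ᵀ = -S := by rw [transpose_neg, hS]
  have hT' : (-T)ᵀ = -T := by rw [transpose_neg, hT]
  have h1 : (-1 : Matrix (Fin 2) (Fin 2) ℂ)ᵀ = -1 := by simp
  have := (((upper hS).mul (lower hT')).mul (upper hS)).mul
    (((upper h1).mul (lower (transpose_one (n := Fin 2) (α := ℂ)))).mul (upper h1))
  convert this using 1
  simp [fromBlocks_multiply, h, h']

/-- For symmetric `T`, symmetry of `T * a` is one linear equation in the three entries of `T`. An
off-diagonal entry of `a` that is not zero lets it be solved with off-diagonal entry 1 and a zero on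
the diagonal, so that `det T = -1`. -/
theorem exists_symm_mul_symm (a : Matrix (Fin 2) (Fin 2) ℂ) :
    ∃ T : Matrix (Fin 2) (Fin 2) ℂ, Tᵀ = T ∧ T.det ≠ 0 ∧ (T * a)ᵀ = T * a := by
  by_cases h1 : a 0 1 = 0
  · by_cases h2 : a 1 0 = 0
    · refine ⟨1, by simp, by simp, ?_⟩
      ext i j
      fin_cases i <;> fin_cases j <;> simp [h1, h2]
    · refine ⟨!![0, 1; 1, (a 1 1 - a 0 0) / a 1 0], ?_, by simp [det_fin_two], ?_⟩
      · ext i j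
        fin_cases i <;> fin_cases j <;> simp
      · ext i j
        fin_cases i <;> fin_cases j <;> simp only [Matrix.mul_apply, Fin.sum_univ_two, transpose_apply] <;> simp [h1]
        all_goals field_simp
        all_goals ring
  · refine ⟨!![(a 0 0 - a 1 1) / a 0 1, 1; 1, 0], ?_, by simp [det_fin_two], ?_⟩
    · ext i j
      fin_cases i <;> fin_cases j <;> simp
    · ext i j
      fin_cases i <;> fin_cases j <;> simp only [Matrix.mul_apply, Fin.sum_univ_two, transpose_apply] <;> simp
      all_goals field_simp
      all_goals ring

/-- Factor `S = R⁻¹ (R S)` into two invertible symmetric matrices and apply `diag_of_symm` to each.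
-/
theorem diag {S T : Matrix (Fin 2) (Fin 2) ℂ} (h : Sᵀ * T = 1) :
    JoinedToOne (fromBlocks S 0 0 T) := by
  obtain ⟨R, hR, hdet, hRS⟩ := exists_symm_mul_symm S
  have hu : IsUnit R.det := hdet.isUnit
  have hSdet : IsUnit S.det := by
    have := congrArg det h
    rw [det_mul, det_transpose, det_one] at this
    exact IsUnit.of_mul_eq_one _ this
  have hRi : (R⁻¹)ᵀ = R⁻¹ := by rw [transpose_nonsing_inv, hR]
  have hT : T = R * (R * S)⁻¹ := by
    have e : T = (Sᵀ)⁻¹ := (inv_eq_right_inv h).symm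
    rw [← hRS, transpose_mul, hR, Matrix.mul_inv_rev, mul_nonsing_inv_cancel_left _ _ hu, e]
  have hu' : IsUnit (R * S).det := by rw [det_mul]; exact hu.mul hSdet
  have k1 := diag_of_symm hRi hR (nonsing_inv_mul _ hu)
  have k2 := diag_of_symm (S := R * S) (T := (R * S)⁻¹) hRS
    (by rw [transpose_nonsing_inv, hRS]) (mul_nonsing_inv _ hu')
  convert k1.mul k2 using 1
  simp only [fromBlocks_multiply, hT]
  simp [nonsing_inv_mul_cancel_left _ _ hu]

/-- Block LDU factorization, with outer factors given by `c a⁻¹` and `a⁻¹ b`. The symplectic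
relations make these two blocks symmetric and force the Schur complement to be `(aᵀ)⁻¹`. -/
theorem of_isUnit {a b c d : Matrix (Fin 2) (Fin 2) ℂ}
    (h : fromBlocks a b c d ∈ symplecticGroup (Fin 2) ℂ) (ha : IsUnit a.det) :
    JoinedToOne (fromBlocks a b c d) := by
  obtain ⟨h1, h2, h3⟩ := SymplecticGroup.fromBlocks_mem_iff.1 h
  have haT : IsUnit aᵀ.det := by rwa [det_transpose]
  have ei : (a⁻¹)ᵀ = (aᵀ)⁻¹ := transpose_nonsing_inv _
  have h1' : c * a⁻¹ = (aᵀ)⁻¹ * cᵀ := by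
    calc c * a⁻¹ = (aᵀ)⁻¹ * (aᵀ * c) * a⁻¹ := by rw [nonsing_inv_mul_cancel_left _ _ haT]
      _ = _ := by rw [h1, Matrix.mul_assoc, Matrix.mul_assoc, mul_nonsing_inv _ ha, mul_one]
  have hc : (c * a⁻¹)ᵀ = c * a⁻¹ := by
    rw [h1', transpose_mul, transpose_transpose, ← ei, transpose_transpose, ei, h1']
  have hd : d = (aᵀ)⁻¹ + c * a⁻¹ * b := by
    have : aᵀ * d = 1 + cᵀ * b := by rw [← h3]; simp
    calc d = (aᵀ)⁻¹ * (aᵀ * d) := by rw [nonsing_inv_mul_cancel_left _ _ haT]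
      _ = _ := by rw [this, Matrix.mul_add, mul_one, h1', Matrix.mul_assoc]
  have hb : (a⁻¹ * b)ᵀ = a⁻¹ * b := by
    have e : bᵀ * (aᵀ)⁻¹ + bᵀ * (c * a⁻¹ * b) = (aᵀ * d - cᵀ * b)ᵀ * (a⁻¹ * b)
        + bᵀ * (c * a⁻¹ * b) := by
      rw [h3, transpose_one, one_mul]
      have : bᵀ * (aᵀ)⁻¹ + bᵀ * (c * a⁻¹ * b) = dᵀ * b := by
        rw [← Matrix.mul_add, ← hd, h2]
      rw [this, hd, transpose_add, ← ei, transpose_transpose, Matrix.add_mul, transpose_mul, hc,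
        Matrix.mul_assoc]
    have e' := add_right_cancel e
    rw [h3, transpose_one, one_mul] at e'
    rw [transpose_mul, ei, e']
  have hD : JoinedToOne (fromBlocks a 0 0 (aᵀ)⁻¹) := diag (mul_nonsing_inv _ haT)
  convert ((lower hc).mul hD).mul (upper hb) using 1
  simp only [fromBlocks_multiply]
  simp [nonsing_inv_mul_cancel_right _ _ ha, mul_nonsing_inv_cancel_left _ _ ha, hd,
    Matrix.mul_assoc, add_comm]

/-- Otherwise `det (a + B c)`, as a polynomial in the entries of `B`, vanishes identically. Its
coefficients and the symmetry of `aᵀ c` then kill all six 2 × 2 minors of the first two columns,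
whereas `det (aᵀ d - cᵀ b) = 1` is a combination of these minors. -/
theorem exists_symm_add {a b c d : Matrix (Fin 2) (Fin 2) ℂ}
    (h : fromBlocks a b c d ∈ symplecticGroup (Fin 2) ℂ) :
    ∃ B : Matrix (Fin 2) (Fin 2) ℂ, Bᵀ = B ∧ (a + B * c).det ≠ 0 := by
  obtain ⟨h1, -, h3⟩ := SymplecticGroup.fromBlocks_mem_iff.1 h
  by_contra! H
  have key : ∀ x y z : ℂ, (a 0 0 * a 1 1 - a 0 1 * a 1 0) + x * (c 0 0 * a 1 1 - c 0 1 * a 1 0)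
      + y * (c 1 0 * a 1 1 - c 1 1 * a 1 0 + a 0 0 * c 0 1 - a 0 1 * c 0 0)
      + z * (a 0 0 * c 1 1 - a 0 1 * c 1 0)
      + (x * z - y ^ 2) * (c 0 0 * c 1 1 - c 0 1 * c 1 0) = 0 := by
    intro x y z
    have := H !![x, y; y, z] (by ext i j; fin_cases i <;> fin_cases j <;> simp)
    simp only [det_fin_two, Matrix.add_apply, Matrix.mul_apply, Fin.sum_univ_two] at this
    simp at this
    linear_combination this
  have e1 := congrFun (congrFun h1 0) 1
  have e2 := congrArg det h3
  simp [det_fin_two, Matrix.mul_apply, Fin.sum_univ_two] at e1 e2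
  have k0 := key 0 0 0
  have k1 := key 1 0 0
  have k2 := key 0 0 1
  have k3 := key 1 0 1
  have k4 := key 0 1 0
  ring_nf at k0 k1 k2 k3 k4
  have m0 : a 0 0 * a 1 1 - a 0 1 * a 1 0 = 0 := by linear_combination k0
  have m1 : c 0 0 * a 1 1 - c 0 1 * a 1 0 = 0 := by linear_combination k1 - k0
  have m2 : a 0 0 * c 1 1 - a 0 1 * c 1 0 = 0 := by linear_combination k2 - k0
  have m3 : c 0 0 * c 1 1 - c 0 1 * c 1 0 = 0 := by linear_combination k3 - k1 - k2 + k0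
  -- The coefficient of `y` is only the difference of two minors; `e1` supplies their sum.
  have m4 : a 0 0 * c 0 1 - a 0 1 * c 0 0 = 0 := by
    linear_combination (k4 - k0 + m3) / 2 + e1 / 2
  have m5 : a 1 0 * c 1 1 - a 1 1 * c 1 0 = 0 := by linear_combination e1 - m4
  have : (0 : ℂ) = 1 := by
    rw [← e2]
    linear_combination -(d 0 0 * d 1 1 - d 0 1 * d 1 0) * m0
      - (b 0 0 * b 1 1 - b 0 1 * b 1 0) * m3 + (d 0 0 * b 0 1 - d 0 1 * b 0 0) * m4
      + (d 0 0 * b 1 1 - d 0 1 * b 1 0) * m2 - (d 1 0 * b 0 1 - d 1 1 * b 0 0) * m1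
      + (d 1 0 * b 1 1 - d 1 1 * b 1 0) * m5
  exact zero_ne_one this

/-- Left multiplication by an upper unipotent matrix makes the corner block invertible, which
reduces to `of_isUnit`. -/
theorem of_mem {A : Matrix (Fin 2 ⊕ Fin 2) (Fin 2 ⊕ Fin 2) ℂ}
    (hA : A ∈ symplecticGroup (Fin 2) ℂ) : JoinedToOne A := by
  rw [← fromBlocks_toBlocks A] at hA ⊢
  set a := A.toBlocks₁₁
  set b := A.toBlocks₁₂
  set c := A.toBlocks₂₁
  set d := A.toBlocks₂₂
  obtain ⟨B, hB, hdet⟩ := exists_symm_add hA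
  have hB' : (-B)ᵀ = -B := by rw [transpose_neg, hB]
  have hmem : fromBlocks 1 B 0 1 * fromBlocks a b c d ∈ symplecticGroup (Fin 2) ℂ :=
    mul_mem (SymplecticGroup.fromBlocks_mem_iff.2 (by simp [hB])) hA
  have e : fromBlocks a b c d =
      fromBlocks 1 (-B) 0 1 * (fromBlocks 1 B 0 1 * fromBlocks a b c d) := by
    rw [← Matrix.mul_assoc, fromBlocks_multiply]
    simp
  rw [e]
  refine (upper hB').mul ?_
  have e' : fromBlocks 1 B 0 1 * fromBlocks a b c d = fromBlocks (a + B * c) (b + B * d) c d := by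
    rw [fromBlocks_multiply]; simp
  rw [e'] at hmem ⊢
  exact of_isUnit hmem hdet.isUnit

end JoinedToOne

/-- The ideal of the polynomials in the matrix entries that vanish on `Sp(4, ℂ)`. -/
def symplecticIdeal : Ideal (MvPolynomial ((Fin 2 ⊕ Fin 2) × (Fin 2 ⊕ Fin 2)) ℂ) where
  carrier := {p | ∀ A ∈ symplecticGroup (Fin 2) ℂ,
    MvPolynomial.eval (fun ij => A ij.1 ij.2) p = 0}
  zero_mem' := by simp
  add_mem' := fun hp hq A hA => by rw [map_add, hp A hA, hq A hA, add_zero]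
  smul_mem' := fun c p hp A hA => by rw [smul_eq_mul, map_mul, hp A hA, mul_zero]

theorem mem_symplecticIdeal {p : MvPolynomial ((Fin 2 ⊕ Fin 2) × (Fin 2 ⊕ Fin 2)) ℂ} :
    p ∈ symplecticIdeal ↔ ∀ A ∈ symplecticGroup (Fin 2) ℂ,
      MvPolynomial.eval (fun ij => A ij.1 ij.2) p = 0 := Iff.rfl

/-- `Sp(4, ℂ)` is an irreducible variety. -/
instance symplecticIdeal_isPrime : symplecticIdeal.IsPrime where
  ne_top' := by
    rw [Ideal.ne_top_iff_one, mem_symplecticIdeal]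
    intro h
    simpa using h 1 (one_mem _)
  mem_or_mem' := by
    intro p q hpq
    simp only [mem_symplecticIdeal] at hpq ⊢
    by_contra! H
    obtain ⟨⟨A, hA, hpA⟩, B, hB, hqB⟩ := H
    have hAB : ((⟨A, hA⟩⁻¹ * ⟨B, hB⟩ : symplecticGroup (Fin 2) ℂ) :
        Matrix (Fin 2 ⊕ Fin 2) (Fin 2 ⊕ Fin 2) ℂ) ∈ symplecticGroup (Fin 2) ℂ :=
      SetLike.coe_mem _
    obtain ⟨C, h1, h2, h3⟩ := JoinedToOne.of_mem hAB
    have hB' : A * (evalRingHom 1).mapMatrix C = B := by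
      rw [h3]
      have : (⟨A, hA⟩ * (⟨A, hA⟩⁻¹ * ⟨B, hB⟩) : symplecticGroup (Fin 2) ℂ) = ⟨B, hB⟩ :=
        mul_inv_cancel_left _ _
      exact congrArg Subtype.val this
    -- The translated curve runs inside the group from `A` at parameter 0 to `B` at parameter 1.
    -- Along it `p q` becomes the zero polynomial in one variable, so `p` or `q` does too, against
    -- `hpA` and `hqB`.
    let D : Matrix (Fin 2 ⊕ Fin 2) (Fin 2 ⊕ Fin 2) ℂ[X] := A.map Polynomial.C * C
    have hD : ∀ t, (evalRingHom t).mapMatrix D = A * (evalRingHom t).mapMatrix C := by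
      intro t
      simp only [D, map_mul]
      congr 1
      ext i j
      simp
    have hev : ∀ (u : MvPolynomial ((Fin 2 ⊕ Fin 2) × (Fin 2 ⊕ Fin 2)) ℂ) (t : ℂ),
        (MvPolynomial.aeval (fun ij => D ij.1 ij.2) u).eval t =
          MvPolynomial.eval (fun ij => (A * (evalRingHom t).mapMatrix C) ij.1 ij.2) u := by
      intro u t
      rw [← hD, ← coe_evalRingHom, MvPolynomial.aeval_def, MvPolynomial.hom_eval₂,
        MvPolynomial.eval]
      congr 1
      ext x
      simp
    have hz : MvPolynomial.aeval (fun ij => D ij.1 ij.2) p *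
        MvPolynomial.aeval (fun ij => D ij.1 ij.2) q = 0 := by
      rw [← map_mul]
      refine Polynomial.funext fun t => ?_
      rw [hev, eval_zero]
      exact hpq _ (mul_mem hA (h1 t))
    rcases mul_eq_zero.1 hz with h | h
    · apply hpA
      have := hev p 0
      rw [h, eval_zero, h2, mul_one] at this
      exact this.symm
    · apply hqB
      have := hev q 1
      rw [h, eval_zero, hB'] at this
      exact this.symm

end Symplectic

/-! ### Linear systems of analytic differential equations -/

section LinearSystem

open Metric Matrix

variable {ι : Type*} [Fintype ι]

/-- Picard iteration, written as a series of increments: each term is the primitive, vanishing at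
`c₀`, of `A` times the previous term. Since `‖t - c₀‖ ≤ 2 ρ` on the disc, the condition `4 ρ K ≤ 1`
halves the bound at each step, wherever `c₀` lies in the disc. -/
theorem exists_linear_ode_solution {A : ℂ → Matrix ι ι ℂ} {c : ℂ} {ρ K : ℝ} (hK : 0 ≤ K)
    (hA : ∀ i j, DifferentiableOn ℂ (fun t => A t i j) (ball c ρ))
    (hAK : ∀ t ∈ ball c ρ, ∀ v, ‖A t *ᵥ v‖ ≤ K * ‖v‖) (hρ : 4 * ρ * K ≤ 1)
    {c₀ : ℂ} (hc₀ : c₀ ∈ ball c ρ) (v : ι → ℂ) :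
    ∃ Y : ℂ → ι → ℂ, Y c₀ = v ∧ ∀ t ∈ ball c ρ, HasDerivAt Y (A t *ᵥ Y t) t := by
  -- The hypothesis on `y` sits inside the existential so that choice yields a total operator `S`,
  -- which can be iterated.
  have step : ∀ y : ℂ → ι → ℂ, ∃ z : ℂ → ι → ℂ, DifferentiableOn ℂ y (ball c ρ) →
      z c₀ = 0 ∧ ∀ t ∈ ball c ρ, HasDerivAt z (A t *ᵥ y t) t := by
    intro y
    by_cases hy : DifferentiableOn ℂ y (ball c ρ)
    · have : DifferentiableOn ℂ (fun t => A t *ᵥ y t) (ball c ρ) := by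
        rw [differentiableOn_pi] at hy ⊢
        intro i
        simp only [mulVec, dotProduct]
        exact DifferentiableOn.fun_sum fun j _ => (hA i j).mul (hy j)
      obtain ⟨z, hz, hz'⟩ := Complex.IsExactOn.with_val_at this.isExactOn_ball c₀ 0
      exact ⟨z, fun _ => ⟨hz, hz'⟩⟩
    · exact ⟨0, fun h => absurd h hy⟩
  choose S hS using step
  let w : ℕ → ℂ → ι → ℂ := fun k => S^[k] (fun _ => v)
  have w0 : w 0 = fun _ => v := rfl
  have wS : ∀ k, w (k + 1) = S (w k) := fun k => Function.iterate_succ_apply' _ _ _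
  have hd : ∀ k, DifferentiableOn ℂ (w k) (ball c ρ) := by
    intro k
    induction k with
    | zero => rw [w0]; exact differentiableOn_const _
    | succ k ih =>
      rw [wS]
      exact fun t ht => ((hS _ ih).2 t ht).differentiableAt.differentiableWithinAt
  have hder : ∀ k, ∀ t ∈ ball c ρ, HasDerivAt (w (k + 1)) (A t *ᵥ w k t) t := by
    intro k t ht
    rw [wS]
    exact (hS _ (hd k)).2 t ht
  have hz : ∀ k, w (k + 1) c₀ = 0 := by
    intro k
    rw [wS]
    exact (hS _ (hd k)).1
  have hb : ∀ k, ∀ t ∈ ball c ρ, ‖w k t‖ ≤ (1 / 2) ^ k * ‖v‖ := by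
    intro k
    induction k with
    | zero => intro t _; simp [w0]
    | succ k ih =>
      intro t ht
      have h1 := (convex_ball c ρ).norm_image_sub_le_of_norm_hasDerivWithin_le
        (f := w (k + 1)) (C := K * ((1 / 2) ^ k * ‖v‖))
        (fun x hx => (hder k x hx).hasDerivWithinAt)
        (fun x hx => (hAK x hx _).trans (mul_le_mul_of_nonneg_left (ih x hx) hK)) hc₀ ht
      rw [hz, sub_zero] at h1
      have h2 : ‖t - c₀‖ ≤ 2 * ρ := by
        rw [← dist_eq_norm]
        have := dist_triangle_right t c₀ c
        rw [mem_ball] at ht hc₀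
        linarith
      calc ‖w (k + 1) t‖ ≤ K * ((1 / 2) ^ k * ‖v‖) * ‖t - c₀‖ := h1
        _ ≤ K * ((1 / 2) ^ k * ‖v‖) * (2 * ρ) := by gcongr
        _ = (4 * ρ * K) * ((1 / 2) ^ (k + 1) * ‖v‖) := by ring
        _ ≤ 1 * ((1 / 2) ^ (k + 1) * ‖v‖) := by gcongr
        _ = _ := one_mul _
  have hsum : Summable fun k : ℕ => (1 / 2 : ℝ) ^ k * ‖v‖ :=
    summable_geometric_two.mul_right _
  have hws : ∀ t ∈ ball c ρ, Summable fun k => w k t := fun t ht =>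
    Summable.of_norm_bounded hsum fun k => hb k t ht
  -- Derivatives of the terms: the constant term `w 0` contributes zero, and from then on the index
  -- is shifted by one.
  let w' : ℕ → ℂ → ι → ℂ := fun k t => Nat.casesOn k 0 fun k => A t *ᵥ w k t
  have hw' : ∀ k, ∀ t ∈ ball c ρ, HasDerivAt (w k) (w' k t) t := by
    intro k t ht
    cases k with
    | zero => rw [w0]; exact hasDerivAt_const _ _
    | succ k => exact hder k t ht
  have hu : Summable fun k : ℕ => (Nat.casesOn k 0 fun k => K * ((1 / 2) ^ k * ‖v‖) : ℝ) :=
    (summable_nat_add_iff 1).1 (hsum.mul_left K)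
  have hbu : ∀ k, ∀ t ∈ ball c ρ,
      ‖w' k t‖ ≤ (Nat.casesOn k 0 fun k => K * ((1 / 2) ^ k * ‖v‖) : ℝ) := by
    intro k t ht
    cases k with
    | zero => simp [w']
    | succ k => exact (hAK t ht _).trans (mul_le_mul_of_nonneg_left (hb k t ht) hK)
  refine ⟨fun t => ∑' k, w k t, ?_, fun t ht => ?_⟩
  · change ∑' k, w k c₀ = v
    rw [(hws c₀ hc₀).tsum_eq_zero_add]
    simp [hz, w0]
  · have h := hasDerivAt_tsum_of_isPreconnected hu isOpen_ball (convex_ball c ρ).isPreconnected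
      hw' hbu hc₀ (hws c₀ hc₀) ht
    suffices e : ∑' k, w' k t = A t *ᵥ ∑' k, w k t by rwa [e] at h
    have hs' : Summable fun k => w' k t := Summable.of_norm_bounded hu fun k => hbu k t ht
    rw [hs'.tsum_eq_zero_add]
    have := (LinearMap.toContinuousLinearMap (mulVecLin (A t))).map_tsum (hws t ht)
    simpa [w'] using this.symm

/-- On a disc of radius `r` with `r K ≤ 1/2`, the mean value inequality at a maximum point of `‖Y‖`
bounds the maximum by half of itself. -/
theorem linear_ode_eventually_eq_zero {A : ℂ → Matrix ι ι ℂ} {c : ℂ} {K : ℝ}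
    (hAK : ∀ᶠ t in 𝓝 c, ∀ v, ‖A t *ᵥ v‖ ≤ K * ‖v‖) {Y : ℂ → ι → ℂ}
    (hY : ∀ᶠ t in 𝓝 c, HasDerivAt Y (A t *ᵥ Y t) t) (hc : Y c = 0) :
    ∀ᶠ t in 𝓝 c, Y t = 0 := by
  obtain ⟨ε, hε, h⟩ := Metric.eventually_nhds_iff_ball.1 (hAK.and hY)
  let K' := max K 0
  have hK' : 0 ≤ K' := le_max_right _ _
  obtain ⟨r, hr0, hrε, hrK⟩ : ∃ r, 0 < r ∧ r < ε ∧ r * K' ≤ 1 / 2 := by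
    refine ⟨min (ε / 2) (1 / (2 * (K' + 1))), by positivity, ?_, ?_⟩
    · exact (min_le_left _ _).trans_lt (by linarith)
    · calc min (ε / 2) (1 / (2 * (K' + 1))) * K' ≤ 1 / (2 * (K' + 1)) * (K' + 1) := by
            gcongr
            · exact min_le_right _ _
            · linarith
        _ = 1 / 2 := by field_simp
  have hsub : closedBall c r ⊆ ball c ε := closedBall_subset_ball hrε
  have hcont : ContinuousOn (fun t => ‖Y t‖) (closedBall c r) := fun t ht =>
    (h t (hsub ht)).2.continuousAt.continuousWithinAt.norm
  obtain ⟨t₀, ht₀, hmax⟩ := (isCompact_closedBall c r).exists_isMaxOn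
    ⟨c, mem_closedBall_self hr0.le⟩ hcont
  have h1 := (convex_closedBall c r).norm_image_sub_le_of_norm_hasDerivWithin_le
    (f := Y) (C := K' * ‖Y t₀‖) (fun x hx => (h x (hsub hx)).2.hasDerivWithinAt)
    (fun x hx => ((h x (hsub hx)).1 _).trans
      (mul_le_mul (le_max_left _ _) (hmax hx) (norm_nonneg _) hK'))
    (mem_closedBall_self hr0.le) ht₀
  rw [hc, sub_zero] at h1
  have h2 : ‖t₀ - c‖ ≤ r := by rwa [← dist_eq_norm]
  have h3 : ‖Y t₀‖ ≤ 1 / 2 * ‖Y t₀‖ := by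
    calc ‖Y t₀‖ ≤ K' * ‖Y t₀‖ * ‖t₀ - c‖ := h1
      _ ≤ K' * ‖Y t₀‖ * r := by gcongr
      _ = r * K' * ‖Y t₀‖ := by ring
      _ ≤ _ := by gcongr
  have h4 : ‖Y t₀‖ ≤ 0 := by linarith [norm_nonneg (Y t₀)]
  filter_upwards [closedBall_mem_nhds c hr0] with t ht
  exact norm_le_zero_iff.1 ((hmax ht).trans h4)

theorem eventually_norm_mulVec_le {A : ℂ → Matrix ι ι ℂ} {c : ℂ}
    (hA : ∀ i j, ContinuousAt (fun t => A t i j) c) :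
    ∃ K, 0 ≤ K ∧ ∀ᶠ t in 𝓝 c, ∀ v, ‖A t *ᵥ v‖ ≤ K * ‖v‖ := by
  refine ⟨∑ i, ∑ j, (‖A c i j‖ + 1), by positivity, ?_⟩
  have h : ∀ᶠ t in 𝓝 c, ∀ i j, ‖A t i j‖ < ‖A c i j‖ + 1 :=
    eventually_all.2 fun i => eventually_all.2 fun j =>
      (hA i j).norm.eventually (gt_mem_nhds (lt_add_one _))
  filter_upwards [h] with t ht v
  rw [pi_norm_le_iff_of_nonneg (by positivity)]
  intro i
  calc ‖(A t *ᵥ v) i‖ ≤ ∑ j, ‖A t i j * v j‖ := norm_sum_le _ _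
    _ ≤ ∑ j, (‖A c i j‖ + 1) * ‖v‖ := by
        gcongr with j
        rw [norm_mul]
        exact mul_le_mul (ht i j).le (norm_le_pi_norm v j) (norm_nonneg _) (by positivity)
    _ = (∑ j, (‖A c i j‖ + 1)) * ‖v‖ := by rw [Finset.sum_mul]
    _ ≤ _ := by
        exact mul_le_mul_of_nonneg_right
          (Finset.single_le_sum (f := fun i => ∑ j, (‖A c i j‖ + 1))
            (fun i _ => by positivity) (Finset.mem_univ i)) (norm_nonneg _)

end LinearSystem

theorem analyticAt_iteratedDeriv {y : ℂ → ℂ} {c : ℂ} (hy : AnalyticAt ℂ y c) (k : ℕ) :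
    AnalyticAt ℂ (iteratedDeriv k y) c := by
  induction k with
  | zero => simpa using hy
  | succ k ih => rw [iteratedDeriv_succ]; exact ih.deriv

/-! ### Local solutions of a scalar equation -/

theorem ratVal_eq (r : RatFunc ℂ) (t : ℂ) : ratVal r t = r.num.eval t / r.denom.eval t := by
  simp [ratVal, RatFunc.eval]

theorem differentiableAt_ratVal {r : RatFunc ℂ} {t : ℂ} (h : r.denom.eval t ≠ 0) :
    DifferentiableAt ℂ (ratVal r) t := by
  have : ratVal r = fun t => r.num.eval t / r.denom.eval t := funext (ratVal_eq r)
  rw [this]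
  exact (Polynomial.differentiableAt _).div (Polynomial.differentiableAt _) h

namespace DiffOp

variable {n : ℕ} {P : DiffOp n}

theorem finite_singular (P : DiffOp n) : {t | ¬ P.Nonsingular t}.Finite := by
  have : {t | ¬ P.Nonsingular t} ⊆ ⋃ i : Fin n, {t | (P.normCoeff i).denom.IsRoot t} := by
    intro t ht
    simp only [Nonsingular, not_forall, Set.mem_ofPred_eq, not_not] at ht
    obtain ⟨i, hi⟩ := ht
    exact Set.mem_iUnion.2 ⟨i, hi⟩
  exact (Set.finite_iUnion fun i =>
    Polynomial.finite_setOfPred_isRoot (RatFunc.denom_ne_zero _)).subset this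

theorem isOpen_nonsingular (P : DiffOp n) : IsOpen {t | P.Nonsingular t} := by
  have := P.finite_singular.isClosed.isOpen_compl
  convert this using 1
  ext t
  simp

/-- `y` is a holomorphic solution of `P y = 0` near `c`. -/
def IsSol (P : DiffOp n) (y : ℂ → ℂ) (c : ℂ) : Prop :=
  AnalyticAt ℂ y c ∧ ∀ᶠ t in 𝓝 c, P.normApply y t = 0

theorem mem_solutions_iff {b : ℂ} {y : ℂ → ℂ} :
    (y : Germ (𝓝 b) ℂ) ∈ P.solutions b ↔ P.IsSol y b := by
  constructor
  · rintro ⟨g, hg, hg1, hg2⟩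
    have hyg : y =ᶠ[𝓝 b] g := Germ.coe_eq.1 hg
    refine ⟨hg1.congr hyg.symm, ?_⟩
    filter_upwards [hg2, hyg.eventually_nhds] with t h1 h2
    have h2' : y =ᶠ[𝓝 t] g := h2
    rw [← h1]
    simp only [normApply, h2'.iteratedDeriv_eq]
  · exact fun h => ⟨y, rfl, h.1, h.2⟩

theorem exists_rep {b : ℂ} (y : P.solutions b) :
    ∃ g : ℂ → ℂ, (y : Germ (𝓝 b) ℂ) = g ∧ P.IsSol g b := by
  obtain ⟨g, h1, h2, h3⟩ := y.2
  exact ⟨g, h1, h2, h3⟩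

theorem IsSol.eventually {c : ℂ} {y : ℂ → ℂ} (hy : P.IsSol y c) :
    ∀ᶠ t in 𝓝 c, P.IsSol y t :=
  hy.1.eventually_analyticAt.and hy.2.eventually_nhds

/-- The vector of the derivatives of order less than `n`. -/
def jet (n : ℕ) (y : ℂ → ℂ) (t : ℂ) : Fin n → ℂ := fun i => iteratedDeriv (i : ℕ) y t

/-- The matrix of the first order system attached to `P`. -/
def companion (P : DiffOp n) (t : ℂ) : Matrix (Fin n) (Fin n) ℂ := fun i j =>
  if (i : ℕ) + 1 = n then - ratVal (P.normCoeff j) t else if (j : ℕ) = i + 1 then 1 else 0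

open Matrix in
theorem companion_mulVec_of_lt (P : DiffOp n) (t : ℂ) (v : Fin n → ℂ) {i : Fin n}
    (h : (i : ℕ) + 1 < n) : (P.companion t *ᵥ v) i = v ⟨i + 1, h⟩ := by
  simp only [mulVec, dotProduct, companion, if_neg h.ne]
  rw [Finset.sum_eq_single ⟨i + 1, h⟩]
  · simp
  · intro j _ hj
    rw [if_neg fun e => hj (Fin.ext e), zero_mul]
  · simp

open Matrix in
theorem companion_mulVec_of_eq (P : DiffOp n) (t : ℂ) (v : Fin n → ℂ) {i : Fin n}
    (h : (i : ℕ) + 1 = n) :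
    (P.companion t *ᵥ v) i = - ∑ j, ratVal (P.normCoeff j) t * v j := by
  simp [mulVec, dotProduct, companion, h]

theorem differentiableAt_companion {t : ℂ} (ht : P.Nonsingular t) (i j : Fin n) :
    DifferentiableAt ℂ (fun t => P.companion t i j) t := by
  unfold companion
  split_ifs
  · exact (differentiableAt_ratVal (ht j)).neg
  · exact differentiableAt_const _
  · exact differentiableAt_const _

open Matrix in
theorem IsSol.hasDerivAt_jet {c : ℂ} {y : ℂ → ℂ} (hy : P.IsSol y c) :
    HasDerivAt (jet n y) (P.companion c *ᵥ jet n y c) c := by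
  rw [hasDerivAt_pi]
  intro i
  have hd : HasDerivAt (fun t => jet n y t i) (iteratedDeriv (i + 1) y c) c := by
    rw [iteratedDeriv_succ]
    exact (analyticAt_iteratedDeriv hy.1 i).differentiableAt.hasDerivAt
  rcases (Nat.succ_le_of_lt i.2).lt_or_eq with h | h
  · rw [companion_mulVec_of_lt P c _ h]
    exact hd
  · rw [companion_mulVec_of_eq P c _ h]
    have h1 : iteratedDeriv (i + 1) y c = - ∑ j, ratVal (P.normCoeff j) c * jet n y c j := by
      have h' : (i : ℕ) + 1 = n := h
      rw [h', eq_neg_iff_add_eq_zero]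
      exact hy.2.self_of_nhds
    rwa [h1] at hd

/-- Cauchy uniqueness: the difference of the jets solves the companion system with zero initial
value. Positivity of `n` gives the jet a component that is the function itself. -/
theorem IsSol.eventuallyEq {c : ℂ} (hc : P.Nonsingular c) {y z : ℂ → ℂ} (hy : P.IsSol y c)
    (hz : P.IsSol z c) (h : jet n y c = jet n z c) (hn : 0 < n) : y =ᶠ[𝓝 c] z := by
  obtain ⟨K, -, hK⟩ := eventually_norm_mulVec_le (A := P.companion) (c := c)
    fun i j => (differentiableAt_companion hc i j).continuousAt
  have := linear_ode_eventually_eq_zero hK (Y := fun t => jet n y t - jet n z t) ?_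
    (sub_eq_zero.2 h)
  · filter_upwards [this] with t ht
    have := congrFun ht ⟨0, hn⟩
    simpa [jet, sub_eq_zero] using this
  · filter_upwards [hy.eventually, hz.eventually] with t h1 h2
    rw [Matrix.mulVec_sub]
    exact h1.hasDerivAt_jet.sub h2.hasDerivAt_jet

/-- Near a non-singular point local solutions exist on a disc of fixed radius, with any initial
values at any point of the disc. -/
theorem exists_ball_solution (hn : 0 < n) {c : ℂ} (hc : P.Nonsingular c) :
    ∃ ρ > 0, Metric.ball c ρ ⊆ {t | P.Nonsingular t} ∧
      ∀ c₀ ∈ Metric.ball c ρ, ∀ v : Fin n → ℂ, ∃ y : ℂ → ℂ,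
        (∀ t ∈ Metric.ball c ρ, P.IsSol y t) ∧ jet n y c₀ = v := by
  obtain ⟨K, hK0, hK⟩ := eventually_norm_mulVec_le (A := P.companion) (c := c)
    fun i j => (differentiableAt_companion hc i j).continuousAt
  obtain ⟨ε, hε, h⟩ := Metric.eventually_nhds_iff_ball.1
    (hK.and (P.isOpen_nonsingular.mem_nhds hc))
  let ρ := min ε (1 / (4 * (K + 1)))
  have hρ0 : 0 < ρ := by positivity
  have hsub : Metric.ball c ρ ⊆ Metric.ball c ε := Metric.ball_subset_ball (min_le_left _ _)
  have hρK : 4 * ρ * K ≤ 1 := by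
    calc 4 * ρ * K ≤ 4 * (1 / (4 * (K + 1))) * (K + 1) := by
          gcongr
          · exact min_le_right _ _
          · linarith
      _ = 1 := by field_simp
  refine ⟨ρ, hρ0, fun t ht => (h t (hsub ht)).2, fun c₀ hc₀ v => ?_⟩
  obtain ⟨Y, hY0, hY⟩ := exists_linear_ode_solution hK0
    (fun i j t ht =>
      (differentiableAt_companion (h t (hsub ht)).2 i j).differentiableWithinAt)
    (fun t ht => (h t (hsub ht)).1) hρK hc₀ v
  have hcomp : ∀ i, ∀ t ∈ Metric.ball c ρ,
      HasDerivAt (fun t => Y t i) ((P.companion t).mulVec (Y t) i) t :=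
    fun i t ht => hasDerivAt_pi.1 (hY t ht) i
  -- The upper rows of the companion matrix say that each component of `Y` is the derivative of the
  -- preceding one, so `Y` is the jet of its component 0.
  have hj : ∀ i : ℕ, ∀ hi : i < n, ∀ t ∈ Metric.ball c ρ,
      iteratedDeriv i (fun t => Y t ⟨0, hn⟩) t = Y t ⟨i, hi⟩ := by
    intro i
    induction i with
    | zero => intro hi t _; simp
    | succ i ih =>
      intro hi t ht
      rw [iteratedDeriv_succ]
      have e : iteratedDeriv i (fun t => Y t ⟨0, hn⟩) =ᶠ[𝓝 t] fun t => Y t ⟨i, by omega⟩ := by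
        filter_upwards [Metric.isOpen_ball.mem_nhds ht] with s hs using ih _ s hs
      rw [e.deriv_eq, (hcomp _ t ht).deriv, companion_mulVec_of_lt P t _ hi]
  refine ⟨fun t => Y t ⟨0, hn⟩, fun t ht => ⟨?_, ?_⟩, ?_⟩
  · exact DifferentiableOn.analyticAt (s := Metric.ball c ρ)
      (fun s hs => (hcomp _ s hs).differentiableAt.differentiableWithinAt)
      (Metric.isOpen_ball.mem_nhds ht)
  · filter_upwards [Metric.isOpen_ball.mem_nhds ht] with s hs
    obtain ⟨m, rfl⟩ := Nat.exists_eq_add_one.2 hn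
    have e : iteratedDeriv m (fun t => Y t ⟨0, hn⟩) =ᶠ[𝓝 s] fun t => Y t (Fin.last m) := by
      filter_upwards [Metric.isOpen_ball.mem_nhds hs] with s' hs' using hj m _ s' hs'
    rw [normApply, iteratedDeriv_succ, e.deriv_eq, (hcomp _ s hs).deriv,
      companion_mulVec_of_eq P s _ (by simp), neg_add_eq_zero]
    exact Finset.sum_congr rfl fun i _ => by rw [hj i i.2 s hs]
  · funext i
    rw [← hY0]
    exact hj i i.2 c₀ hc₀

/-- The radius depends on `c` alone, not on `c₀` or `y`; this uniformity is what lets continuation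
along a compact path end after finitely many discs. -/
theorem exists_ball_extension (hn : 0 < n) {c : ℂ} (hc : P.Nonsingular c) :
    ∃ ρ > 0, ∀ c₀ ∈ Metric.ball c ρ, ∀ y, P.IsSol y c₀ →
      ∃ z, (∀ t ∈ Metric.ball c ρ, P.IsSol z t) ∧ z =ᶠ[𝓝 c₀] y := by
  obtain ⟨ρ, hρ, hsub, h⟩ := exists_ball_solution hn hc
  refine ⟨ρ, hρ, fun c₀ hc₀ y hy => ?_⟩
  obtain ⟨z, hz, hz'⟩ := h c₀ hc₀ (jet n y c₀)
  exact ⟨z, hz, (hz c₀ hc₀).eventuallyEq (hsub hc₀) hy hz' hn⟩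

end DiffOp

/-! ### Properties of analytic continuation -/

section Continuation

/-- The functions `g s` are the members of an analytic continuation along `γ`. -/
def IsContinuation {b c : ℂ} (γ : Path b c) (g : unitInterval → ℂ → ℂ) : Prop :=
  (∀ s, AnalyticAt ℂ (g s) (γ s)) ∧ ∀ s, ∀ᶠ s' in 𝓝 s, g s' =ᶠ[𝓝 (γ s')] g s

variable {b c : ℂ} {γ : Path b c}

namespace IsContinuation

variable {g h : unitInterval → ℂ → ℂ}

theorem continuesAlong (hg : IsContinuation γ g) :
    ContinuesAlong γ (g 0 : Germ (𝓝 b) ℂ) (g 1 : Germ (𝓝 c) ℂ) :=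
  ⟨g, hg.1, hg.2, rfl, rfl⟩

theorem of_analyticAt {k : ℂ → ℂ} (hk : ∀ s, AnalyticAt ℂ k (γ s)) :
    IsContinuation γ fun _ => k :=
  ⟨hk, fun _ => Eventually.of_forall fun _ => EventuallyEq.rfl⟩

theorem add (hg : IsContinuation γ g) (hh : IsContinuation γ h) :
    IsContinuation γ fun s => g s + h s :=
  ⟨fun s => (hg.1 s).add (hh.1 s), fun s => by
    filter_upwards [hg.2 s, hh.2 s] with s' h1 h2 using h1.add h2⟩

theorem mul (hg : IsContinuation γ g) (hh : IsContinuation γ h) :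
    IsContinuation γ fun s => g s * h s :=
  ⟨fun s => (hg.1 s).mul (hh.1 s), fun s => by
    filter_upwards [hg.2 s, hh.2 s] with s' h1 h2 using h1.mul h2⟩

theorem const_smul (hg : IsContinuation γ g) (a : ℂ) : IsContinuation γ fun s => a • g s :=
  ⟨fun s => (hg.1 s).const_smul, fun s => by
    filter_upwards [hg.2 s] with s' h1 using h1.const_smul a⟩

/-- The parameters at which the germ vanishes form a clopen subset of the interval: open by local
coherence, closed by the identity theorem on a disc. -/
theorem eventuallyEq_zero (hg : IsContinuation γ g) (h0 : g 0 =ᶠ[𝓝 b] 0) (s : unitInterval) :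
    g s =ᶠ[𝓝 (γ s)] 0 := by
  have hclopen : IsClopen {s | g s =ᶠ[𝓝 (γ s)] 0} := by
    refine ⟨isClosed_iff_frequently.2 fun s hs => ?_, isOpen_iff_mem_nhds.2 fun s hs => ?_⟩
    · obtain ⟨ρ, hρ, hball⟩ := Metric.eventually_nhds_iff_ball.1 (hg.1 s).eventually_analyticAt
      obtain ⟨s', hs', h1, h2⟩ := (hs.and_eventually ((hg.2 s).and
        (γ.continuous.continuousAt.eventually (Metric.ball_mem_nhds (γ s) hρ)))).exists
      have h3 : g s =ᶠ[𝓝 (γ s')] 0 := h1.symm.trans hs'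
      have := AnalyticOnNhd.eqOn_zero_of_preconnected_of_eventuallyEq_zero (f := g s)
        (U := Metric.ball (γ s) ρ) hball (convex_ball _ _).isPreconnected h2 h3
      exact this.eventuallyEq_of_mem (Metric.ball_mem_nhds _ hρ)
    · have hs' : g s =ᶠ[𝓝 (γ s)] 0 := hs
      filter_upwards [hg.2 s, γ.continuous.continuousAt.eventually hs'.eventually_nhds]
        with s' h1 h2
      exact h1.trans h2
  have huniv := hclopen.eq_univ ⟨0, by simpa using h0⟩
  have : s ∈ {s | g s =ᶠ[𝓝 (γ s)] 0} := huniv ▸ Set.mem_univ s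
  exact this

end IsContinuation

namespace ContinuesAlong

theorem exists_isContinuation {y : Germ (𝓝 b) ℂ} {z : Germ (𝓝 c) ℂ}
    (h : ContinuesAlong γ y z) :
    ∃ g, IsContinuation γ g ∧ y = (g 0 : Germ (𝓝 b) ℂ) ∧ z = (g 1 : Germ (𝓝 c) ℂ) := by
  obtain ⟨g, h1, h2, h3, h4⟩ := h
  exact ⟨g, ⟨h1, h2⟩, h3, h4⟩

theorem add {y y' : Germ (𝓝 b) ℂ} {z z' : Germ (𝓝 c) ℂ} (h : ContinuesAlong γ y z)
    (h' : ContinuesAlong γ y' z') : ContinuesAlong γ (y + y') (z + z') := by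
  obtain ⟨g, hg, rfl, rfl⟩ := h.exists_isContinuation
  obtain ⟨k, hk, rfl, rfl⟩ := h'.exists_isContinuation
  exact (hg.add hk).continuesAlong

theorem mul {y y' : Germ (𝓝 b) ℂ} {z z' : Germ (𝓝 c) ℂ} (h : ContinuesAlong γ y z)
    (h' : ContinuesAlong γ y' z') : ContinuesAlong γ (y * y') (z * z') := by
  obtain ⟨g, hg, rfl, rfl⟩ := h.exists_isContinuation
  obtain ⟨k, hk, rfl, rfl⟩ := h'.exists_isContinuation
  exact (hg.mul hk).continuesAlong

theorem const_smul {y : Germ (𝓝 b) ℂ} {z : Germ (𝓝 c) ℂ} (h : ContinuesAlong γ y z) (a : ℂ) :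
    ContinuesAlong γ (a • y) (a • z) := by
  obtain ⟨g, hg, rfl, rfl⟩ := h.exists_isContinuation
  exact (hg.const_smul a).continuesAlong

theorem zero : ContinuesAlong γ 0 0 :=
  (IsContinuation.of_analyticAt (k := 0) fun _ => analyticAt_const).continuesAlong

theorem sum {ι : Type*} (s : Finset ι) {y : ι → Germ (𝓝 b) ℂ} {z : ι → Germ (𝓝 c) ℂ}
    (h : ∀ i, ContinuesAlong γ (y i) (z i)) :
    ContinuesAlong γ (∑ i ∈ s, y i) (∑ i ∈ s, z i) := by
  classical
  induction s using Finset.induction_on with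
  | empty => simpa using zero
  | insert i s hi ih =>
    rw [Finset.sum_insert hi, Finset.sum_insert hi]
    exact (h i).add ih

theorem eq_zero {z : Germ (𝓝 c) ℂ} (h : ContinuesAlong γ 0 z) : z = 0 := by
  obtain ⟨g, hg, h0, rfl⟩ := h.exists_isContinuation
  have := hg.eventuallyEq_zero (Germ.coe_eq.1 h0.symm) 1
  rw [γ.target] at this
  exact Germ.coe_eq.2 this

theorem unique {y : Germ (𝓝 b) ℂ} {z z' : Germ (𝓝 c) ℂ} (h : ContinuesAlong γ y z)
    (h' : ContinuesAlong γ y z') : z = z' := by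
  have := (h.add (h'.const_smul (-1)))
  rw [neg_smul, neg_smul, one_smul, one_smul, ← sub_eq_add_neg, ← sub_eq_add_neg, sub_self] at this
  exact sub_eq_zero.1 this.eq_zero

end ContinuesAlong

/-- Solutions can be continued along every path which avoids the singular points. -/
theorem DiffOp.IsSol.exists_continuesAlong {n : ℕ} {P : DiffOp n} (hn : 0 < n)
    (hγ : ∀ s, P.Nonsingular (γ s)) {y : ℂ → ℂ} (hy : P.IsSol y b) :
    ∃ z, P.IsSol z c ∧ ContinuesAlong γ (y : Germ (𝓝 b) ℂ) (z : Germ (𝓝 c) ℂ) := by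
  choose ρ hρ hext using fun s => P.exists_ball_extension hn (hγ s)
  -- A Lebesgue number subdivision: each piece of the path stays in one disc of extension.
  obtain ⟨t, ht0, htm, ⟨N, hN⟩, ht⟩ := exists_monotone_Icc_subset_open_cover_unitInterval
    (c := fun s => γ ⁻¹' Metric.ball (γ s) (ρ s))
    (fun s => Metric.isOpen_ball.preimage γ.continuous)
    (fun s _ => Set.mem_iUnion.2 ⟨s, Metric.mem_ball_self (hρ s)⟩)
  -- Coherence is required only for `s' ≤ t m`, since the values of `g` beyond `t m` are arbitrary
  -- until replaced at the next stage.
  have key : ∀ m, ∃ g : unitInterval → ℂ → ℂ, g 0 = y ∧ (∀ s ≤ t m, P.IsSol (g s) (γ s)) ∧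
      ∀ s ≤ t m, ∀ᶠ s' in 𝓝 s, s' ≤ t m → g s' =ᶠ[𝓝 (γ s')] g s := by
    intro m
    induction m with
    | zero =>
      refine ⟨fun _ => y, rfl, fun s hs => ?_, fun s _ =>
        Eventually.of_forall fun _ _ => EventuallyEq.rfl⟩
      rw [ht0] at hs
      have : s = 0 := le_antisymm hs unitInterval.nonneg'
      rw [this, γ.source]
      exact hy
    | succ m ih =>
      obtain ⟨g, g1, g2, g3⟩ := ih
      obtain ⟨i, hi⟩ := ht m
      obtain ⟨z, hz, hzg⟩ := hext i (γ (t m)) (hi ⟨le_rfl, htm (Nat.le_succ m)⟩) (g (t m))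
        (g2 _ le_rfl)
      let G : unitInterval → ℂ → ℂ := fun s => if s ≤ t m then g s else z
      have G1 : ∀ s, s ≤ t m → G s = g s := fun s hs => if_pos hs
      have G2 : ∀ s, ¬ s ≤ t m → G s = z := fun s hs => if_neg hs
      refine ⟨G, ?_, fun s hs => ?_, fun s hs => ?_⟩
      · rw [G1 0 unitInterval.nonneg', g1]
      · by_cases h : s ≤ t m
        · rw [G1 s h]; exact g2 s h
        · rw [G2 s h]; exact hz _ (hi ⟨(not_le.1 h).le, hs⟩)
      · rcases lt_trichotomy s (t m) with h | h | h
        · filter_upwards [g3 s h.le, gt_mem_nhds h] with s' h1 h2 _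
          rw [G1 s' h2.le, G1 s h.le]
          exact h1 h2.le
        · subst h
          filter_upwards [g3 _ le_rfl, γ.continuous.continuousAt.eventually hzg.eventually_nhds]
            with s' h1 h2 _
          rw [G1 _ le_rfl]
          by_cases h' : s' ≤ t m
          · rw [G1 s' h']; exact h1 h'
          · rw [G2 s' h']; exact h2
        · filter_upwards [lt_mem_nhds h] with s' h1 _
          rw [G2 s' (not_le.2 h1), G2 s (not_le.2 h)]
  obtain ⟨g, g1, g2, g3⟩ := key N
  rw [hN N le_rfl] at g2 g3
  refine ⟨g 1, ?_, ?_⟩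
  · have := g2 1 le_rfl
    rwa [γ.target] at this
  · have hg : IsContinuation γ g := by
      refine ⟨fun s => (g2 s unitInterval.le_one').1, fun s => ?_⟩
      filter_upwards [g3 s unitInterval.le_one'] with s' h using h unitInterval.le_one'
    rw [← g1]
    exact hg.continuesAlong

/-- A disc is homeomorphic to the plane, where complements of countable sets are path connected. -/
theorem isPathConnected_ball_diff_countable (x : ℂ) {ρ : ℝ} (hρ : 0 < ρ) {S : Set ℂ}
    (hS : S.Countable) : IsPathConnected (Metric.ball x ρ \ S) := by
  let φ := OpenPartialHomeomorph.univBall x ρ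
  have hs : φ.source = Set.univ := OpenPartialHomeomorph.univBall_source x ρ
  have ht : φ.target = Metric.ball x ρ := OpenPartialHomeomorph.univBall_target x hρ
  have hinj : Function.Injective φ := by
    have := φ.injOn
    rwa [hs, Set.injOn_univ] at this
  have h := (hS.preimage hinj).isPathConnected_compl_of_one_lt_rank
    (E := ℂ) (by simp [Complex.rank_real_complex])
  have h' := h.image' (f := φ) (OpenPartialHomeomorph.continuous_univBall x ρ).continuousOn
  convert h' using 1
  ext z
  constructor
  · rintro ⟨h1, h2⟩
    rw [← ht] at h1
    exact ⟨φ.symm z, by simpa [φ.right_inv h1] using h2, φ.right_inv h1⟩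
  · rintro ⟨w, hw, rfl⟩
    exact ⟨ht ▸ φ.map_source (hs ▸ Set.mem_univ w), hw⟩

theorem exists_near_notMem {S : Set ℂ} (hS : S.Countable) {x : ℂ} {p : ℂ → Prop}
    (h : ∀ᶠ z in 𝓝 x, p z) : ∃ z, p z ∧ z ∉ S := by
  have := mem_closure_iff_frequently.1 ((hS.dense_compl ℝ) x)
  obtain ⟨z, h1, h2⟩ := (this.and_eventually h).exists
  exact ⟨z, h2, h1⟩

/-- A finite family of germs which can be continued along a path can also be continued, with the
same result, along a path which avoids a given countable set. -/
theorem exists_continuesAlong_avoiding {ι : Type*} [Finite ι] {S : Set ℂ} (hS : S.Countable)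
    (hb : b ∉ S) (hc : c ∉ S) {y : ι → Germ (𝓝 b) ℂ} {z : ι → Germ (𝓝 c) ℂ}
    (h : ∀ i, ContinuesAlong γ (y i) (z i)) :
    ∃ δ : Path b c, (∀ s, δ s ∉ S) ∧ ∀ i, ContinuesAlong δ (y i) (z i) := by
  choose g hg hy hz using fun i => (h i).exists_isContinuation
  -- `R s x`: the family of germs of parameter `s`, taken at `x`, is reached from `b` by a path
  -- avoiding `S`. The point `γ s` may itself lie in `S`, so the connectedness argument below speaks
  -- of all `x` near `γ s` outside `S`.
  let R : unitInterval → ℂ → Prop := fun s x => ∃ δ : Path b x, (∀ u, δ u ∉ S) ∧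
    ∀ i, ContinuesAlong δ (y i) (g i s : Germ (𝓝 x) ℂ)
  have hext : ∀ s, ∃ ρ > 0, ∀ x ∈ Metric.ball (γ s) ρ, x ∉ S → R s x →
      ∀ x' ∈ Metric.ball (γ s) ρ, x' ∉ S → R s x' := by
    intro s
    obtain ⟨ρ, hρ, hball⟩ := Metric.eventually_nhds_iff_ball.1
      (eventually_all.2 fun i => ((hg i).1 s).eventually_analyticAt)
    refine ⟨ρ, hρ, fun x hx hxS hR x' hx' hxS' => ?_⟩
    obtain ⟨δ, hδ, hδg⟩ := hR
    have hj := (isPathConnected_ball_diff_countable (γ s) hρ hS).joinedIn x ⟨hx, hxS⟩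
      x' ⟨hx', hxS'⟩
    refine ⟨δ.trans hj.somePath, fun u => ?_, fun i => (hδg i).trans ?_⟩
    · have : (δ.trans hj.somePath) u ∈ Set.range δ ∪ Set.range hj.somePath := by
        rw [← Path.trans_range]; exact ⟨u, rfl⟩
      rcases this with ⟨u', h⟩ | ⟨u', h⟩
      · rw [← h]; exact hδ u'
      · rw [← h]; exact (hj.somePath_mem u').2
    · exact (IsContinuation.of_analyticAt
        fun u => hball _ (hj.somePath_mem u).1 i).continuesAlong
  have hclopen : IsClopen {s | ∀ᶠ x in 𝓝 (γ s), x ∉ S → R s x} := by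
    have hloc : ∀ s, ∀ᶠ s' in 𝓝 s, ∀ᶠ x in 𝓝 (γ s'), ∀ i,
        (g i s' : Germ (𝓝 x) ℂ) = (g i s : Germ (𝓝 x) ℂ) := by
      intro s
      filter_upwards [eventually_all.2 fun i => (hg i).2 s] with s' hs'
      refine eventually_all.2 fun i => ?_
      filter_upwards [(hs' i).eventually_nhds] with x hx using Germ.coe_eq.2 hx
    refine ⟨isClosed_iff_frequently.2 fun s hs => ?_, isOpen_iff_mem_nhds.2 fun s hs => ?_⟩
    · obtain ⟨ρ, hρ, hball⟩ := hext s
      obtain ⟨s', hs', h1, h2⟩ := (hs.and_eventually ((hloc s).and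
        (γ.continuous.continuousAt.eventually (Metric.ball_mem_nhds (γ s) hρ)))).exists
      obtain ⟨x, ⟨⟨hx1, hx2⟩, hx3⟩, hxS⟩ := exists_near_notMem hS
        ((Eventually.and hs' h1).and (Metric.isOpen_ball.mem_nhds h2))
      have hR : R s x := by
        obtain ⟨δ, hδ, hδg⟩ := hx1 hxS
        exact ⟨δ, hδ, fun i => hx2 i ▸ hδg i⟩
      filter_upwards [Metric.ball_mem_nhds (γ s) hρ] with x' hx' hxS'
      exact hball x hx3 hxS hR x' hx' hxS'
    · have hs' : ∀ᶠ x in 𝓝 (γ s), x ∉ S → R s x := hs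
      filter_upwards [hloc s, γ.continuous.continuousAt.eventually hs'.eventually_nhds]
        with s' h1 h2
      filter_upwards [h1, h2] with x hx1 hx2 hxS
      obtain ⟨δ, hδ, hδg⟩ := hx2 hxS
      exact ⟨δ, hδ, fun i => (hx1 i).symm ▸ hδg i⟩
  have h0 : ∀ᶠ x in 𝓝 (γ 0), x ∉ S → R 0 x := by
    obtain ⟨ρ, hρ, hball⟩ := hext 0
    have hR : R 0 b := ⟨Path.refl b, fun _ => hb, fun i => by
      rw [hy i]
      exact ContinuesAlong.refl rfl (by simpa using (hg i).1 0)⟩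
    filter_upwards [Metric.ball_mem_nhds (γ 0) hρ] with x' hx' hxS'
    exact hball b (by simpa using hρ) hb hR x' hx' hxS'
  have huniv := hclopen.eq_univ ⟨0, h0⟩
  have h1 : (1 : unitInterval) ∈ {s | ∀ᶠ x in 𝓝 (γ s), x ∉ S → R s x} := huniv ▸ Set.mem_univ _
  have h1' : ∀ᶠ x in 𝓝 (γ 1), x ∉ S → R 1 x := h1
  have h2 := h1'.self_of_nhds
  rw [γ.target] at h2
  obtain ⟨δ, hδ, hδg⟩ := h2 hc
  exact ⟨δ, hδ, fun i => hz i ▸ hδg i⟩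

end Continuation

/-! ### Values of rational functions -/

theorem denom_eval_ne_zero_of_div {p q : Polynomial ℂ} {t : ℂ} (hq : q.eval t ≠ 0) :
    (algebraMap _ (RatFunc ℂ) p / algebraMap _ (RatFunc ℂ) q).denom.eval t ≠ 0 := by
  have hq0 : q ≠ 0 := by rintro rfl; simp at hq
  obtain ⟨d, hd⟩ := (RatFunc.denom_dvd hq0).2 ⟨p, rfl⟩
  intro h
  apply hq
  rw [hd, Polynomial.eval_mul, h, zero_mul]

theorem ratVal_div {p q : Polynomial ℂ} {t : ℂ} (hq : q.eval t ≠ 0) :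
    ratVal (algebraMap _ (RatFunc ℂ) p / algebraMap _ (RatFunc ℂ) q) t =
      p.eval t / q.eval t := by
  have hq0 : q ≠ 0 := by rintro rfl; simp at hq
  have hd := denom_eval_ne_zero_of_div (p := p) hq
  rw [ratVal_eq, div_eq_div_iff hd hq, ← Polynomial.eval_mul, ← Polynomial.eval_mul]
  congr 1
  apply IsFractionRing.injective (Polynomial ℂ) (RatFunc ℂ)
  rw [map_mul, map_mul]
  have h := RatFunc.num_div_denom (algebraMap _ (RatFunc ℂ) p / algebraMap _ (RatFunc ℂ) q)
  rwa [div_eq_div_iff (RatFunc.algebraMap_ne_zero (RatFunc.denom_ne_zero _))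
    (RatFunc.algebraMap_ne_zero hq0)] at h

/-! ### Functions with a logarithmic derivative with simple poles -/

section LogDeriv

open Polynomial

/-- The polynomial `∏ (t - a)`. -/
def logDen (A : Finset ℂ) : ℂ[X] := ∏ a ∈ A, (X - C a)

/-- The numerator of `∑ α a / (t - a)`. -/
def logNum (A : Finset ℂ) (α : ℂ → ℂ) : ℂ[X] := ∑ a ∈ A, C (α a) * logDen (A.erase a)

variable {A : Finset ℂ} {α : ℂ → ℂ} {b : ℂ} {f : ℂ → ℂ}

theorem logDen_eval_ne_zero {t : ℂ} (ht : t ∉ A) : (logDen A).eval t ≠ 0 := by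
  rw [logDen, eval_prod, Finset.prod_ne_zero_iff]
  intro a ha
  rw [eval_sub, eval_X, eval_C, sub_ne_zero]
  rintro rfl
  exact ht ha

theorem logNum_div_logDen {t : ℂ} (ht : t ∉ A) :
    (logNum A α).eval t / (logDen A).eval t = ∑ a ∈ A, α a / (t - a) := by
  rw [logNum, eval_finsetSum, Finset.sum_div]
  refine Finset.sum_congr rfl fun a ha => ?_
  have hta : t - a ≠ 0 := by
    rw [sub_ne_zero]; rintro rfl; exact ht ha
  have h := logDen_eval_ne_zero ht
  rw [div_eq_div_iff h hta, ← show (X - C a) * logDen (A.erase a) = logDen A from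
    Finset.mul_prod_erase _ (fun a => X - C a) ha]
  simp
  ring

/-- The operator `d/dt - ∑ α a / (t - a)`. -/
def logOp (A : Finset ℂ) (α : ℂ → ℂ) : DiffOp 1 where
  coeff := ![algebraMap _ (RatFunc ℂ) (-logNum A α) / algebraMap _ (RatFunc ℂ) (logDen A), 1]
  lead_ne_zero := by simp [Fin.last]

theorem logOp_normCoeff (i : Fin 1) : (logOp A α).normCoeff i =
    algebraMap _ (RatFunc ℂ) (-logNum A α) / algebraMap _ (RatFunc ℂ) (logDen A) := by
  fin_cases i
  simp [DiffOp.normCoeff, logOp, Fin.last]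

theorem logOp_nonsingular {t : ℂ} (ht : t ∉ A) : (logOp A α).Nonsingular t := fun i => by
  rw [logOp_normCoeff]
  exact denom_eval_ne_zero_of_div (logDen_eval_ne_zero ht)

theorem logOp_normApply (y : ℂ → ℂ) {t : ℂ} (ht : t ∉ A) :
    (logOp A α).normApply y t = deriv y t - (∑ a ∈ A, α a / (t - a)) * y t := by
  rw [← logNum_div_logDen ht]
  simp only [DiffOp.normApply, logOp_normCoeff, ratVal_div (logDen_eval_ne_zero ht),
    Finset.univ_unique, Finset.sum_singleton, iteratedDeriv_one, eval_neg]
  simp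
  ring

/-- Near `b` the function `f` is analytic without zeros, and `f' / f = ∑ α a / (t - a)`. -/
structure HasLogDeriv (f : ℂ → ℂ) (b : ℂ) (A : Finset ℂ) (α : ℂ → ℂ) : Prop where
  notMem : b ∉ A
  analyticAt : AnalyticAt ℂ f b
  ne_zero : f b ≠ 0
  deriv_eq : ∀ᶠ t in 𝓝 b, deriv f t = (∑ a ∈ A, α a / (t - a)) * f t

theorem eventually_notMem_finset {b : ℂ} {A : Finset ℂ} (hb : b ∉ A) : ∀ᶠ t in 𝓝 b, t ∉ A :=
  A.finite_toSet.isClosed.isOpen_compl.mem_nhds hb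

namespace HasLogDeriv

theorem isSol (hf : HasLogDeriv f b A α) : (logOp A α).IsSol f b := by
  refine ⟨hf.analyticAt, ?_⟩
  filter_upwards [hf.deriv_eq, eventually_notMem_finset hf.notMem] with t h1 h2
  rw [logOp_normApply f h2, h1, sub_self]

theorem inv (hf : HasLogDeriv f b A α) : HasLogDeriv f⁻¹ b A (-α) := by
  refine ⟨hf.notMem, hf.analyticAt.inv hf.ne_zero, inv_ne_zero hf.ne_zero, ?_⟩
  filter_upwards [hf.deriv_eq, hf.analyticAt.eventually_analyticAt,
    hf.analyticAt.continuousAt.eventually_ne hf.ne_zero] with t h1 h2 h3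
  rw [deriv_inv'' h2.differentiableAt h3, h1]
  simp only [Pi.neg_apply, neg_div, Finset.sum_neg_distrib, Pi.inv_apply]
  field_simp

theorem sq (hf : HasLogDeriv f b A α) : HasLogDeriv (fun t => f t ^ 2) b A (2 • α) := by
  refine ⟨hf.notMem, hf.analyticAt.pow 2, pow_ne_zero _ hf.ne_zero, ?_⟩
  filter_upwards [hf.deriv_eq, hf.analyticAt.eventually_analyticAt] with t h1 h2
  rw [(h2.differentiableAt.hasDerivAt.fun_pow 2).deriv, h1]
  simp only [Pi.smul_apply, nsmul_eq_mul, mul_div_assoc, ← Finset.mul_sum]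
  push_cast
  ring

/-- Local solutions of the first order equation are multiples of `f`. -/
theorem exists_eq_smul (hf : HasLogDeriv f b A α) {z : ℂ → ℂ} (hz : (logOp A α).IsSol z b) :
    ∃ χ : ℂ, z =ᶠ[𝓝 b] χ • f := by
  refine ⟨z b / f b, ?_⟩
  have hs : (logOp A α).IsSol ((z b / f b) • f) b := by
    rw [← DiffOp.mem_solutions_iff]
    exact Submodule.smul_mem _ (z b / f b) (DiffOp.mem_solutions_iff.2 hf.isSol)
  refine hz.eventuallyEq (logOp_nonsingular hf.notMem) hs ?_ one_pos
  funext i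
  fin_cases i
  simp [DiffOp.jet, div_mul_cancel₀ _ hf.ne_zero]

theorem exists_continuesAlong (hf : HasLogDeriv f b A α) {γ : Path b b} (hγ : ∀ s, γ s ∉ A) :
    ∃ χ : ℂ, ContinuesAlong γ (f : Germ (𝓝 b) ℂ) (χ • (f : Germ (𝓝 b) ℂ)) := by
  obtain ⟨z, hz, hz'⟩ := hf.isSol.exists_continuesAlong one_pos
    fun s => logOp_nonsingular (hγ s)
  obtain ⟨χ, hχ⟩ := hf.exists_eq_smul hz
  refine ⟨χ, ?_⟩
  rw [Germ.coe_eq.2 hχ] at hz'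
  exact hz'

/-- The rational function `r` continues to itself along `γ`, while `f ^ 2` continues to `χ² f ^ 2`;
uniqueness compares the two. -/
theorem sq_eq_one_of_continuesAlong (hf : HasLogDeriv f b A α) {γ : Path b b} {r : RatFunc ℂ}
    (hr : ∀ᶠ t in 𝓝 b, f t ^ 2 = ratVal r t) (hγ : ∀ s, r.denom.eval (γ s) ≠ 0) {χ : ℂ}
    (hχ : ContinuesAlong γ (f : Germ (𝓝 b) ℂ) (χ • (f : Germ (𝓝 b) ℂ))) : χ ^ 2 = 1 := by
  have ha : ∀ s, AnalyticAt ℂ (ratVal r) (γ s) := fun s =>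
    DifferentiableOn.analyticAt (s := {t | r.denom.eval t ≠ 0})
      (fun t ht => (differentiableAt_ratVal ht).differentiableWithinAt)
      ((isOpen_ne_fun r.denom.continuous continuous_const).mem_nhds (hγ s))
  have h1 := hχ.mul hχ
  have h2 := (IsContinuation.of_analyticAt ha).continuesAlong
  have e : (f : Germ (𝓝 b) ℂ) * f = (ratVal r : Germ (𝓝 b) ℂ) := by
    refine Germ.coe_eq.2 ?_
    filter_upwards [hr] with t ht
    rw [← ht, pow_two]
  rw [e] at h1
  have h3 := h1.unique h2
  rw [← e] at h3
  have h4 : (χ • f) * (χ • f) =ᶠ[𝓝 b] f * f := Germ.coe_eq.1 h3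
  have h5 := h4.self_of_nhds
  simp only [Pi.mul_apply, Pi.smul_apply, smul_eq_mul] at h5
  have h6 : (χ ^ 2 - 1) * f b ^ 2 = 0 := by linear_combination h5
  rcases mul_eq_zero.1 h6 with h | h
  · exact sub_eq_zero.1 h
  · exact absurd h (pow_ne_zero _ hf.ne_zero)

end HasLogDeriv

theorem derivative_div_eq_sum {p : ℂ[X]} {t : ℂ} (ht : p.eval t ≠ 0) (hA : p.roots.toFinset ⊆ A) :
    p.derivative.eval t / p.eval t = ∑ a ∈ A, (p.rootMultiplicity a : ℂ) / (t - a) := by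
  rw [(IsAlgClosed.splits p).eval_derivative_div_eval_of_ne_zero ht,
    Finset.sum_multiset_map_count]
  -- Points of `A` that are not roots enter with multiplicity zero.
  rw [← Finset.sum_subset hA]
  · refine Finset.sum_congr rfl fun a _ => ?_
    rw [nsmul_eq_mul, count_roots, mul_one_div]
  · intro a _ ha
    rw [← count_roots, Multiset.count_eq_zero_of_notMem (by simpa using ha)]
    simp

/-- Differentiating `f ^ n = r` logarithmically gives `f'/f = (1/n) r'/r`. Thus `A` consists of the
zeros and poles of `r`, and `α` is the order of `r` divided by `n`. -/
theorem exists_hasLogDeriv (hf : AnalyticAt ℂ f b) (hfb : f b ≠ 0) {n : ℕ} (hn : 1 ≤ n)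
    {r : RatFunc ℂ} (hr : ∀ᶠ t in 𝓝 b, f t ^ n = ratVal r t) :
    ∃ A α, HasLogDeriv f b A α ∧ ∀ t ∉ A, r.denom.eval t ≠ 0 := by
  have hb0 : r.num.eval b / r.denom.eval b ≠ 0 := by
    rw [← ratVal_eq, ← hr.self_of_nhds]
    exact pow_ne_zero _ hfb
  obtain ⟨hnum, hden⟩ := div_ne_zero_iff.1 hb0
  have hnum0 : r.num ≠ 0 := by intro h; simp [h] at hnum
  have hden0 : r.denom ≠ 0 := RatFunc.denom_ne_zero r
  refine ⟨r.num.roots.toFinset ∪ r.denom.roots.toFinset, fun a =>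
    ((r.num.rootMultiplicity a : ℂ) - r.denom.rootMultiplicity a) / n,
    ⟨?_, hf, hfb, ?_⟩, ?_⟩
  · simp [hnum, hden]
  · filter_upwards [hr.eventually_nhds, hf.eventually_analyticAt,
      hf.continuousAt.eventually_ne hfb,
      r.num.continuous.continuousAt.eventually_ne hnum,
      r.denom.continuous.continuousAt.eventually_ne hden] with t h1 h2 h3 h4 h5
    have e1 := derivative_div_eq_sum h4 (Finset.subset_union_left (s₂ := r.denom.roots.toFinset))
    have e2 := derivative_div_eq_sum h5 (Finset.subset_union_right (s₁ := r.num.roots.toFinset))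
    have e3 : (∑ a ∈ r.num.roots.toFinset ∪ r.denom.roots.toFinset,
        ((r.num.rootMultiplicity a : ℂ) - r.denom.rootMultiplicity a) / n / (t - a)) =
        (r.num.derivative.eval t / r.num.eval t - r.denom.derivative.eval t / r.denom.eval t) / n := by
      rw [e1, e2, ← Finset.sum_sub_distrib, Finset.sum_div]
      exact Finset.sum_congr rfl fun a _ => by ring
    rw [e3]
    have hn0 : (n : ℂ) ≠ 0 := by exact_mod_cast (Nat.pos_of_ne_zero (by omega)).ne'
    have hev : (fun t => f t ^ n) =ᶠ[𝓝 t] fun t => r.num.eval t / r.denom.eval t := by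
      filter_upwards [h1] with s hs
      rw [hs, ratVal_eq]
    have hd := hev.deriv_eq
    rw [(h2.differentiableAt.hasDerivAt.fun_pow n).deriv,
      ((r.num.hasDerivAt t).fun_div (r.denom.hasDerivAt t) h5).deriv] at hd
    have hv : f t ^ n = r.num.eval t / r.denom.eval t := hev.self_of_nhds
    have hpow : f t ^ n = f t ^ (n - 1) * f t := by
      rw [← pow_succ, Nat.sub_add_cancel hn]
    have hfn : f t ^ (n - 1) ≠ 0 := pow_ne_zero _ h3
    have hnum' : r.num.eval t = f t ^ (n - 1) * f t * r.denom.eval t := by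
      rw [← hpow, hv, div_mul_cancel₀ _ h5]
    rw [eq_div_iff (pow_ne_zero _ h5)] at hd
    rw [hnum'] at hd ⊢
    have e4 : (r.num.derivative.eval t / (f t ^ (n - 1) * f t * r.denom.eval t) -
        r.denom.derivative.eval t / r.denom.eval t) / n * f t = (r.num.derivative.eval t -
          f t ^ (n - 1) * f t * r.denom.derivative.eval t) / (n * f t ^ (n - 1) * r.denom.eval t) := by
      field_simp
    rw [e4, eq_div_iff (mul_ne_zero (mul_ne_zero hn0 hfn) h5)]
    apply mul_left_cancel₀ h5
    linear_combination hd
  · intro t ht h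
    apply ht
    simp [hden0, h]

end LogDeriv

/-! ### The monodromy of a function with a logarithmic derivative with simple poles -/

section Circle

open Complex

variable {A : Finset ℂ} {α : ℂ → ℂ} {b : ℂ} {f : ℂ → ℂ}

/-- The angle `2 π s` in the form `2 π i s`. -/
def circleAngle (s : unitInterval) : ℂ := 2 * Real.pi * (s : ℝ) * I

theorem continuous_circleAngle : Continuous circleAngle := by
  unfold circleAngle; fun_prop

/-- The circle with center `a` through `c`. -/
def circlePath (a c : ℂ) : Path c c where
  toFun s := a + (c - a) * exp (circleAngle s)
  continuous_toFun := by
    have := continuous_circleAngle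
    fun_prop
  source' := by simp [circleAngle]
  target' := by simp [circleAngle]

theorem circlePath_apply (a c : ℂ) (s : unitInterval) :
    circlePath a c s = a + (c - a) * exp (circleAngle s) := rfl

theorem norm_circlePath_sub (a c : ℂ) (s : unitInterval) :
    ‖circlePath a c s - a‖ = ‖c - a‖ := by
  have : circleAngle s = ((2 * Real.pi * (s : ℝ) : ℝ) : ℂ) * I := by
    simp [circleAngle]
  rw [circlePath_apply, add_sub_cancel_left, norm_mul, this, norm_exp_ofReal_mul_I, mul_one]

/-- The branch of `log ((t - a) / (c - a))` near the point of parameter `s` of the circle. -/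
def logBranch (a c : ℂ) (s : unitInterval) (t : ℂ) : ℂ :=
  log ((t - a) / (c - a) * exp (-circleAngle s)) + circleAngle s

theorem mul_exp_neg_circlePath {a c : ℂ} (h : c ≠ a) (s : unitInterval) :
    (circlePath a c s - a) / (c - a) * exp (-circleAngle s) = 1 := by
  have : c - a ≠ 0 := sub_ne_zero.2 h
  rw [circlePath_apply, add_sub_cancel_left, mul_div_cancel_left₀ _ this, ← exp_add,
    add_neg_cancel, exp_zero]

theorem hasDerivAt_logBranch {a c t : ℂ} (h : c ≠ a) {s : unitInterval}
    (ht : (t - a) / (c - a) * exp (-circleAngle s) ∈ slitPlane) :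
    HasDerivAt (logBranch a c s) (1 / (t - a)) t := by
  have hca : c - a ≠ 0 := sub_ne_zero.2 h
  have hta : t - a ≠ 0 := by
    intro h0
    rw [h0, zero_div, zero_mul] at ht
    exact absurd ht zero_notMem_slitPlane
  have h1 : HasDerivAt (fun t => (t - a) / (c - a) * exp (-circleAngle s))
      (1 / (c - a) * exp (-circleAngle s)) t :=
    (((hasDerivAt_id t).sub_const a).div_const (c - a)).mul_const _
  have h2 := (h1.clog ht).add_const (circleAngle s)
  refine h2.congr_deriv ?_
  have := exp_ne_zero (-circleAngle s)
  field_simp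

theorem logBranch_eventually_eq {a c : ℂ} (h : c ≠ a) (s : unitInterval) :
    ∀ᶠ s' in 𝓝 s, logBranch a c s' =ᶠ[𝓝 (circlePath a c s')] logBranch a c s := by
  have hclose : ∀ᶠ s' : unitInterval in 𝓝 s, |(s' : ℝ) - s| < 1 / 4 := by
    have : ContinuousAt (fun s' : unitInterval => |(s' : ℝ) - s|) s := by fun_prop
    refine this.tendsto.eventually_lt_const ?_
    norm_num
  filter_upwards [hclose] with s' hs'
  have hre : ∀ᶠ t in 𝓝 (circlePath a c s'),
      0 < ((t - a) / (c - a) * exp (-circleAngle s')).re := by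
    have hc : ContinuousAt (fun t => ((t - a) / (c - a) * exp (-circleAngle s')).re)
        (circlePath a c s') := by fun_prop
    refine hc.eventually_const_lt ?_
    beta_reduce
    rw [mul_exp_neg_circlePath h]
    simp
  filter_upwards [hre] with t ht
  have hpi := Real.pi_pos
  -- Parameters closer than 1/4 differ in angle by less than `π/2`, and positive real part bounds
  -- the other argument by `π/2`. The sum stays within `(-π, π)`, where the principal logarithm is
  -- additive.
  have harg := abs_lt.1 (abs_arg_lt_pi_div_two_iff.2 (Or.inl ht))
  have hs := abs_lt.1 hs'
  have him : (circleAngle s' - circleAngle s).im = 2 * Real.pi * ((s' : ℝ) - s) := by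
    simp [circleAngle]
    ring
  have hlog : log (exp (circleAngle s' - circleAngle s)) = circleAngle s' - circleAngle s := by
    refine log_exp ?_ ?_ <;> rw [him] <;> nlinarith
  have harg2 : arg (exp (circleAngle s' - circleAngle s)) = 2 * Real.pi * ((s' : ℝ) - s) := by
    rw [← log_im, hlog, him]
  have hne : (t - a) / (c - a) * exp (-circleAngle s') ≠ 0 := by
    intro h0
    rw [h0] at ht
    simp at ht
  have e : (t - a) / (c - a) * exp (-circleAngle s) =
      (t - a) / (c - a) * exp (-circleAngle s') * exp (circleAngle s' - circleAngle s) := by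
    rw [mul_assoc, ← exp_add]
    congr 2
    ring
  have hmul := (log_mul_eq_add_log_iff hne (exp_ne_zero (circleAngle s' - circleAngle s))).2
    (by rw [harg2]; constructor <;> nlinarith)
  rw [logBranch, logBranch, e, hmul, hlog]
  ring

/-- The germ at `c` of a solution of `y' = (∑ α a / (t - a)) y` picks up the factor
`exp (2 π i α a)` along a small circle around `a`. -/
theorem HasLogDeriv.continuesAlong_circlePath {a c : ℂ} {ρ : ℝ} {k : ℂ → ℂ}
    (hk : HasLogDeriv k c A α) (ha : a ∈ A) (hc : c ∈ Metric.ball a ρ)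
    (hA : ∀ a' ∈ A, a' ∈ Metric.ball a ρ → a' = a) :
    ContinuesAlong (circlePath a c) (k : Germ (𝓝 c) ℂ)
      (exp (2 * Real.pi * I * α a) • (k : Germ (𝓝 c) ℂ)) := by
  have hca : c ≠ a := by rintro rfl; exact hk.notMem ha
  have hdiff : DifferentiableOn ℂ (fun t => ∑ a' ∈ A.erase a, α a' / (t - a'))
      (Metric.ball a ρ) := by
    refine DifferentiableOn.fun_sum fun a' ha' => ?_
    refine (differentiableOn_const _).div (by fun_prop) fun t ht => sub_ne_zero.2 ?_
    rintro rfl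
    exact (Finset.mem_erase.1 ha').1 (hA t (Finset.mem_erase.1 ha').2 ht)
  -- The terms with poles other than `a` have a single-valued primitive on the disc, so only the
  -- logarithm at `a` contributes monodromy to the explicit solution `κ`.
  obtain ⟨H, hH⟩ := hdiff.isExactOn_ball
  let κ : unitInterval → ℂ → ℂ := fun s t => exp (α a * logBranch a c s t + H t)
  have hmem : ∀ s, circlePath a c s ∈ Metric.ball a ρ := fun s => by
    rw [Metric.mem_ball, dist_eq_norm, norm_circlePath_sub, ← dist_eq_norm]
    exact hc
  have hslit : ∀ s, ∀ᶠ t in 𝓝 (circlePath a c s),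
      (t - a) / (c - a) * exp (-circleAngle s) ∈ slitPlane := fun s => by
    have hcont : ContinuousAt (fun t => (t - a) / (c - a) * exp (-circleAngle s))
      (circlePath a c s) := by fun_prop
    refine hcont.eventually (isOpen_slitPlane.mem_nhds ?_)
    beta_reduce
    rw [mul_exp_neg_circlePath hca]
    exact one_mem_slitPlane
  have hder : ∀ s, ∀ᶠ t in 𝓝 (circlePath a c s),
      HasDerivAt (κ s) ((∑ a' ∈ A, α a' / (t - a')) * κ s t) t := fun s => by
    filter_upwards [hslit s, Metric.isOpen_ball.mem_nhds (hmem s)] with t h1 h2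
    have := (((hasDerivAt_logBranch hca h1).const_mul (α a)).add (hH t h2)).cexp
    refine this.congr_deriv ?_
    rw [← Finset.add_sum_erase _ _ ha]
    simp only [κ, Pi.add_apply]
    ring
  have han : ∀ s, AnalyticAt ℂ (κ s) (circlePath a c s) := fun s =>
    analyticAt_iff_eventually_differentiableAt.2 <| by
      filter_upwards [hder s] with t ht using ht.differentiableAt
  have hcont : IsContinuation (circlePath a c) κ := by
    refine ⟨han, fun s => ?_⟩
    filter_upwards [logBranch_eventually_eq hca s] with s' hs'
    filter_upwards [hs'] with t ht
    simp only [κ, ht]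
  have h0 : (circlePath a c) 0 = c := (circlePath a c).source
  have hlog0 : HasLogDeriv (κ 0) c A α := by
    refine ⟨hk.notMem, h0 ▸ han 0, exp_ne_zero _, ?_⟩
    have := hder 0
    rw [h0] at this
    filter_upwards [this] with t ht using ht.deriv
  -- The given germ is a multiple of the explicit solution, hence picks up the same factor.
  obtain ⟨χ, hχ⟩ := hlog0.exists_eq_smul hk.isSol
  have h1 : κ 1 = exp (2 * Real.pi * I * α a) • κ 0 := by
    funext t
    have e1 : circleAngle 1 = 2 * Real.pi * I := by simp [circleAngle]
    have e0 : circleAngle 0 = 0 := by simp [circleAngle]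
    simp only [κ, Pi.smul_apply, smul_eq_mul, logBranch, e1, e0, exp_neg, exp_two_pi_mul_I,
      exp_zero, inv_one, mul_one, add_zero]
    rw [← exp_add]
    congr 1
    ring
  have hfin := hcont.continuesAlong.const_smul χ
  rw [h1] at hfin
  have ek : (k : Germ (𝓝 c) ℂ) = χ • (κ 0 : Germ (𝓝 c) ℂ) := Germ.coe_eq.2 hχ
  rw [ek, smul_comm]
  exact hfin

/-- There is a loop along which `f` picks up the factor `exp (2 π i α a)`. -/
theorem HasLogDeriv.exists_loop (hf : HasLogDeriv f b A α) {S : Set ℂ} (hS : S.Finite)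
    (hAS : ↑A ⊆ S) (hbS : b ∉ S) {a : ℂ} (ha : a ∈ A) :
    ∃ γ : Path b b, (∀ s, γ s ∉ S) ∧ ContinuesAlong γ (f : Germ (𝓝 b) ℂ)
      (exp (2 * Real.pi * I * α a) • (f : Germ (𝓝 b) ℂ)) := by
  obtain ⟨ρ, hρ, hball⟩ := Metric.isOpen_iff.1 
    (hS.subset (Set.sdiff_subset (t := {a}))).isClosed.isOpen_compl a (by simp)
  have hball' : ∀ x ∈ Metric.ball a ρ, x ∈ S → x = a := fun x hx hxS => by
    by_contra hne
    exact hball hx ⟨hxS, hne⟩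
  obtain ⟨c, hc, hcS⟩ := exists_near_notMem hS.countable (Metric.ball_mem_nhds a hρ)
  have hca : c ≠ a := by rintro rfl; exact hcS (hAS ha)
  have hconn : IsPathConnected Sᶜ := hS.countable.isPathConnected_compl_of_one_lt_rank
    (by simp [Complex.rank_real_complex])
  have hj := hconn.joinedIn b hbS c hcS
  obtain ⟨k, hk, hk'⟩ := hf.isSol.exists_continuesAlong one_pos
    (γ := hj.somePath) fun s => logOp_nonsingular fun h => hj.somePath_mem s (hAS h)
  -- If the continued solution vanished at `c`, it would be zero near `c`, and going back along the
  -- path would make `f` zero near `b`.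
  have hkc : k c ≠ 0 := by
    intro h0
    have hz : k =ᶠ[𝓝 c] 0 := by
      refine hk.eventuallyEq (z := 0) (logOp_nonsingular fun h => hcS (hAS h)) ?_ ?_ one_pos
      · exact DiffOp.mem_solutions_iff.1 (Submodule.zero_mem _)
      · funext i
        fin_cases i
        simpa [DiffOp.jet] using h0
    rw [Germ.coe_eq.2 hz] at hk'
    have := hk'.symm.eq_zero
    exact hf.ne_zero (Germ.coe_eq.1 this).self_of_nhds
  have hklog : HasLogDeriv k c A α := by
    refine ⟨fun h => hcS (hAS h), hk.1, hkc, ?_⟩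
    filter_upwards [hk.2, eventually_notMem_finset fun h => hcS (hAS h)] with t h1 h2
    rw [logOp_normApply k h2, sub_eq_zero] at h1
    exact h1
  have hcirc := hklog.continuesAlong_circlePath ha hc fun a' ha' h => hball' a' h (hAS ha')
  have hcircS : ∀ s, circlePath a c s ∉ S := fun s hs => by
    have hn := norm_circlePath_sub a c s
    have : circlePath a c s ∈ Metric.ball a ρ := by
      rw [Metric.mem_ball, dist_eq_norm, hn, ← dist_eq_norm]
      exact hc
    rw [hball' _ this hs, sub_self, norm_zero, eq_comm, norm_eq_zero, sub_eq_zero] at hn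
    exact hca hn
  -- The loop is a lasso: out to `c`, once around `a`, and back the same way.
  refine ⟨(hj.somePath.trans (circlePath a c)).trans hj.somePath.symm, fun s => ?_,
    (hk'.trans hcirc).trans (hk'.symm.const_smul _)⟩
  have hmem : ((hj.somePath.trans (circlePath a c)).trans hj.somePath.symm) s ∈
      Set.range (((hj.somePath.trans (circlePath a c)).trans hj.somePath.symm)) := ⟨s, rfl⟩
  rw [Path.trans_range, Path.trans_range, Path.symm_range] at hmem
  rcases hmem with (⟨u, hu⟩ | ⟨u, hu⟩) | ⟨u, hu⟩
  · rw [← hu]; exact hj.somePath_mem u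
  · rw [← hu]; exact hcircS u
  · rw [← hu]; exact hj.somePath_mem u

theorem hasLogDeriv_prod_zpow (hb : b ∉ A) (k : ℂ → ℤ) :
    HasLogDeriv (fun t => ∏ a ∈ A, (t - a) ^ k a) b A (fun a => k a) := by
  have hne : ∀ {t : ℂ}, t ∉ A → ∀ a ∈ A, t - a ≠ 0 := fun ht a ha => by
    rw [sub_ne_zero]; rintro rfl; exact ht ha
  refine ⟨hb, ?_, ?_, ?_⟩
  · exact Finset.analyticAt_fun_prod _ fun a ha =>
      AnalyticAt.zpow (by fun_prop) (hne hb a ha)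
  · exact Finset.prod_ne_zero_iff.2 fun a ha => zpow_ne_zero _ (hne hb a ha)
  · filter_upwards [eventually_notMem_finset hb] with t ht
    have hz : ∏ a ∈ A, (t - a) ^ k a ≠ 0 :=
      Finset.prod_ne_zero_iff.2 fun a ha => zpow_ne_zero _ (hne ht a ha)
    rw [← div_eq_iff hz]
    change logDeriv (fun t => ∏ a ∈ A, (t - a) ^ k a) t = _
    rw [logDeriv_prod (f := fun a t => (t - a) ^ k a) (fun a ha => zpow_ne_zero _ (hne ht a ha)) (fun a ha =>
      (by fun_prop : DifferentiableAt ℂ (fun t => t - a) t).zpow (Or.inl (hne ht a ha)))]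
    refine Finset.sum_congr rfl fun a ha => ?_
    rw [logDeriv_fun_zpow (by fun_prop)]
    simp [logDeriv, div_eq_mul_inv]

theorem isRationalAt_prod_zpow (hb : b ∉ A) (k : ℂ → ℤ) (d : ℂ) :
    IsRationalAt b (fun t => d * ∏ a ∈ A, (t - a) ^ k a) := by
  let p : Polynomial ℂ := Polynomial.C d * ∏ a ∈ A, (Polynomial.X - Polynomial.C a) ^ (k a).toNat
  let q : Polynomial ℂ := ∏ a ∈ A, (Polynomial.X - Polynomial.C a) ^ (-k a).toNat
  refine ⟨algebraMap _ _ p / algebraMap _ _ q, ?_⟩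
  filter_upwards [eventually_notMem_finset hb] with t ht
  have hne : ∀ a ∈ A, t - a ≠ 0 := fun a ha => by
    rw [sub_ne_zero]; rintro rfl; exact ht ha
  have hq : q.eval t = ∏ a ∈ A, (t - a) ^ (-k a).toNat := by simp [q, Polynomial.eval_prod]
  have hp : p.eval t = d * ∏ a ∈ A, (t - a) ^ (k a).toNat := by simp [p, Polynomial.eval_prod]
  have hq0 : q.eval t ≠ 0 := by
    rw [hq]
    exact Finset.prod_ne_zero_iff.2 fun a ha => pow_ne_zero _ (hne a ha)
  rw [ratVal_div hq0, hp, hq, mul_div_assoc, ← Finset.prod_div_distrib]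
  congr 1
  refine Finset.prod_congr rfl fun a ha => ?_
  conv_lhs => rw [← Int.toNat_sub_toNat_neg (k a), zpow_sub₀ (hne a ha), zpow_natCast,
    zpow_natCast]

/-- `f` and `∏ (t - a) ^ k a` have the same logarithmic derivative, hence are proportional. -/
theorem HasLogDeriv.isRationalAt_of_int (hf : HasLogDeriv f b A α)
    (h : ∀ a ∈ A, ∃ m : ℤ, α a = m) : IsRationalAt b f := by
  choose! k hk using h
  have hG := hasLogDeriv_prod_zpow hf.notMem k
  have hf' : HasLogDeriv f b A (fun a => k a) := by
    refine ⟨hf.notMem, hf.analyticAt, hf.ne_zero, ?_⟩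
    filter_upwards [hf.deriv_eq] with t ht
    rw [ht]
    congr 1
    exact Finset.sum_congr rfl fun a ha => by rw [hk a ha]
  obtain ⟨χ, hχ⟩ := hG.exists_eq_smul hf'.isSol
  obtain ⟨r, hr⟩ := isRationalAt_prod_zpow hf.notMem k χ
  refine ⟨r, ?_⟩
  filter_upwards [hχ, hr] with t h1 h2
  rw [h1, ← h2]
  rfl

/-- If `f ^ 2` has trivial monodromy, then it is a rational function. -/
theorem HasLogDeriv.isRationalAt_sq (hf : HasLogDeriv f b A α)
    (h : ∀ a ∈ A, exp (2 * Real.pi * I * α a) ^ 2 = 1) : IsRationalAt b (fun t => f t ^ 2) := by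
  refine hf.sq.isRationalAt_of_int fun a ha => ?_
  have h1 := h a ha
  rw [← exp_nat_mul, exp_eq_one_iff] at h1
  obtain ⟨m, hm⟩ := h1
  refine ⟨m, ?_⟩
  have hpi : (2 * Real.pi * I : ℂ) ≠ 0 := two_pi_I_ne_zero
  apply mul_left_cancel₀ hpi
  simp only [Pi.smul_apply, nsmul_eq_mul]
  linear_combination hm

end Circle

/-! ### The shift as an isomorphism of solution spaces -/

namespace DiffOp

variable {n : ℕ} {P Q : DiffOp n} {b : ℂ}

theorem jet_eq_of_eventuallyEq {y z : ℂ → ℂ} {t : ℂ} (h : y =ᶠ[𝓝 t] z) : jet n y t = jet n z t :=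
  funext fun i => h.iteratedDeriv_eq i

/-- The initial values at `b` of the local solutions. -/
def jetMap (P : DiffOp n) (b : ℂ) : P.solutions b →ₗ[ℂ] (Fin n → ℂ) where
  toFun y := jet n (P.exists_rep y).choose b
  map_add' y z := by
    obtain ⟨h1, h2⟩ := (P.exists_rep y).choose_spec
    obtain ⟨k1, k2⟩ := (P.exists_rep z).choose_spec
    obtain ⟨l1, l2⟩ := (P.exists_rep (y + z)).choose_spec
    have l3 := (congrArg₂ (· + ·) h1 k1).symm.trans l1
    rw [← jet_eq_of_eventuallyEq (Germ.coe_eq.1 l3)]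
    funext i
    exact iteratedDeriv_add h2.1.contDiffAt k2.1.contDiffAt
  map_smul' a y := by
    obtain ⟨h1, h2⟩ := (P.exists_rep y).choose_spec
    obtain ⟨l1, l2⟩ := (P.exists_rep (a • y)).choose_spec
    have l3 := (congrArg (a • ·) h1).symm.trans l1
    rw [← jet_eq_of_eventuallyEq (Germ.coe_eq.1 l3)]
    funext i
    exact iteratedDeriv_const_smul h2.1.contDiffAt a

theorem jetMap_apply {y : ℂ → ℂ} (hy : P.IsSol y b) :
    P.jetMap b ⟨(y : Germ (𝓝 b) ℂ), mem_solutions_iff.2 hy⟩ = jet n y b := by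
  obtain ⟨h1, h2⟩ := (P.exists_rep ⟨(y : Germ (𝓝 b) ℂ), mem_solutions_iff.2 hy⟩).choose_spec
  exact (jet_eq_of_eventuallyEq (Germ.coe_eq.1 h1)).symm

theorem jetMap_injective (hn : 0 < n) (hb : P.Nonsingular b) :
    Function.Injective (P.jetMap b) := by
  intro y z h
  obtain ⟨g, hg, hg'⟩ := P.exists_rep y
  obtain ⟨k, hk, hk'⟩ := P.exists_rep z
  have ey : y = ⟨(g : Germ (𝓝 b) ℂ), mem_solutions_iff.2 hg'⟩ := Subtype.ext hg
  have ez : z = ⟨(k : Germ (𝓝 b) ℂ), mem_solutions_iff.2 hk'⟩ := Subtype.ext hk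
  rw [ey, ez, jetMap_apply hg', jetMap_apply hk'] at h
  rw [ey, ez]
  exact Subtype.ext (Germ.coe_eq.2 (hg'.eventuallyEq hb hk' h hn))

theorem finiteDimensional_solutions (hn : 0 < n) (hb : P.Nonsingular b) :
    FiniteDimensional ℂ (P.solutions b) :=
  FiniteDimensional.of_injective _ (jetMap_injective hn hb)

theorem finrank_solutions_le (hn : 0 < n) (hb : P.Nonsingular b) :
    Module.finrank ℂ (P.solutions b) ≤ n := by
  simpa using LinearMap.finrank_le_finrank_of_injective (jetMap_injective hn hb)

/-- A linear isomorphism of solution spaces given by multiplication by `f`. -/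
def IsMulBy (φ : P.solutions b ≃ₗ[ℂ] Q.solutions b) (f : ℂ → ℂ) : Prop :=
  ∀ y, (φ y : Germ (𝓝 b) ℂ) = (f : Germ (𝓝 b) ℂ) * y

theorem germ_inv_mul_cancel {f : ℂ → ℂ} (hf : AnalyticAt ℂ f b) (hfb : f b ≠ 0)
    (y : Germ (𝓝 b) ℂ) : ((f⁻¹ : ℂ → ℂ) : Germ (𝓝 b) ℂ) * ((f : Germ (𝓝 b) ℂ) * y) = y := by
  have : ((f⁻¹ : ℂ → ℂ) : Germ (𝓝 b) ℂ) * (f : Germ (𝓝 b) ℂ) = 1 := by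
    refine Germ.coe_eq.2 ?_
    filter_upwards [hf.continuousAt.eventually_ne hfb] with t ht
    simp [ht]
  rw [← mul_assoc, this, one_mul]

theorem germ_mul_smul (a : ℂ) (x y : Germ (𝓝 b) ℂ) : x * (a • y) = a • (x * y) := by
  induction x, y using Germ.inductionOn₂ with
  | _ x y => exact congrArg Germ.ofFun (mul_smul_comm a x y)

theorem germ_smul_mul (a : ℂ) (x y : Germ (𝓝 b) ℂ) : (a • x) * y = a • (x * y) := by
  rw [mul_comm, germ_mul_smul, mul_comm]

/-- Multiplication by `f` as a linear map between solution spaces. -/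
def shiftMap {f : ℂ → ℂ} (h : P.IsShift Q b f) : P.solutions b →ₗ[ℂ] Q.solutions b where
  toFun y := ⟨(f : Germ (𝓝 b) ℂ) * y, h y y.2⟩
  map_add' _ _ := Subtype.ext (mul_add _ _ _)
  map_smul' a _ := Subtype.ext (germ_mul_smul a _ _)

theorem shiftMap_injective {f : ℂ → ℂ} (hf : AnalyticAt ℂ f b) (hfb : f b ≠ 0)
    (h : P.IsShift Q b f) : Function.Injective (shiftMap h) := by
  intro y z hyz
  have e : (f : Germ (𝓝 b) ℂ) * (y : Germ (𝓝 b) ℂ) = (f : Germ (𝓝 b) ℂ) * z :=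
    congrArg Subtype.val hyz
  refine Subtype.ext ?_
  rw [← germ_inv_mul_cancel hf hfb y, e, germ_inv_mul_cancel hf hfb]

/-- Injectivity gives one inequality of dimensions; the bound of the second dimension by the order
`n` gives the other. -/
theorem IsShift.exists_equiv (hn : 0 < n) (hQ : Q.Nonsingular b) {f : ℂ → ℂ}
    (hf : AnalyticAt ℂ f b) (hfb : f b ≠ 0) (h : P.IsShift Q b f)
    (hdim : Module.finrank ℂ (P.solutions b) = n) :
    ∃ φ : P.solutions b ≃ₗ[ℂ] Q.solutions b, IsMulBy φ f := by
  have hinj := shiftMap_injective hf hfb h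
  have := finiteDimensional_solutions hn hQ
  have : FiniteDimensional ℂ (P.solutions b) := FiniteDimensional.of_injective _ hinj
  have hle := LinearMap.finrank_le_finrank_of_injective hinj
  have heq : Module.finrank ℂ (P.solutions b) = Module.finrank ℂ (Q.solutions b) :=
    le_antisymm hle ((finrank_solutions_le hn hQ).trans hdim.ge)
  have hsurj := (LinearMap.injective_iff_surjective_of_finrank_eq_finrank heq).1 hinj
  have hbij : Function.Bijective (shiftMap h) := ⟨hinj, hsurj⟩
  exact ⟨LinearEquiv.ofBijective (shiftMap h) hbij,
    fun y => congrArg Subtype.val (LinearEquiv.ofBijective_apply _ y)⟩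

theorem IsMulBy.symm {φ : P.solutions b ≃ₗ[ℂ] Q.solutions b} {f : ℂ → ℂ} (h : IsMulBy φ f)
    (hf : AnalyticAt ℂ f b) (hfb : f b ≠ 0) : IsMulBy φ.symm f⁻¹ := by
  intro z
  have := h (φ.symm z)
  rw [LinearEquiv.apply_symm_apply] at this
  rw [this, germ_inv_mul_cancel hf hfb]

/-! ### Monodromy of an operator and of its shift -/

/-- `M` is the analytic continuation of the solutions of `P` along `γ`. -/
def IsMonodromyAlong (M : LinearMap.GeneralLinearGroup ℂ (P.solutions b)) (γ : Path b b) : Prop :=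
  ∀ y : P.solutions b, ContinuesAlong γ (y : Germ (𝓝 b) ℂ) (M.1 y : Germ (𝓝 b) ℂ)

/-- Uniqueness of continuation makes the result linear in the initial germ; the reversed path
supplies the inverse. -/
theorem exists_isMonodromyAlong (hn : 0 < n) {γ : Path b b} (hγ : ∀ s, P.Nonsingular (γ s)) :
    ∃ M : LinearMap.GeneralLinearGroup ℂ (P.solutions b), IsMonodromyAlong M γ := by
  have key : ∀ δ : Path b b, (∀ s, P.Nonsingular (δ s)) → ∃ L : P.solutions b →ₗ[ℂ] P.solutions b,
      ∀ y : P.solutions b, ContinuesAlong δ (y : Germ (𝓝 b) ℂ) (L y : Germ (𝓝 b) ℂ) := by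
    intro δ hδ
    have hex : ∀ y : P.solutions b, ∃ z : P.solutions b,
        ContinuesAlong δ (y : Germ (𝓝 b) ℂ) (z : Germ (𝓝 b) ℂ) := by
      intro y
      obtain ⟨g, hg, hg'⟩ := P.exists_rep y
      obtain ⟨z, hz, hz'⟩ := hg'.exists_continuesAlong hn hδ
      exact ⟨⟨z, mem_solutions_iff.2 hz⟩, hg ▸ hz'⟩
    choose L hL using hex
    exact ⟨
      { toFun := L
        map_add' := fun y z => Subtype.ext ((hL (y + z)).unique ((hL y).add (hL z)))
        map_smul' := fun a y => Subtype.ext ((hL (a • y)).unique ((hL y).const_smul a)) }, hL⟩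
  obtain ⟨L, hL⟩ := key γ hγ
  obtain ⟨L', hL'⟩ := key γ.symm fun s => hγ _
  refine ⟨⟨L, L', ?_, ?_⟩, hL⟩
  · refine LinearMap.ext fun y => Subtype.ext ?_
    have h := (hL' y).symm
    rw [Path.symm_symm] at h
    exact (hL (L' y)).unique h
  · exact LinearMap.ext fun y => Subtype.ext ((hL' (L y)).unique (hL y).symm)

theorem mem_monodromyGroup_of_isMonodromyAlong (hb : P.Nonsingular b)
    {M : LinearMap.GeneralLinearGroup ℂ (P.solutions b)} {γ : Path b b} (hM : IsMonodromyAlong M γ)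
    (hγ : ∀ s, P.Nonsingular (γ s)) : M ∈ P.monodromyGroup hb :=
  ⟨γ, hγ, hM⟩

/-- Loops defining the monodromy of `P` may pass through points where `f` or `Q` is singular. The
detour is made for the finitely many basis elements at once and extends to all solutions by
linearity. -/
theorem exists_isMonodromyAlong_avoiding {ι : Type*} [Finite ι]
    (e : Module.Basis ι ℂ (P.solutions b)) {hb : P.Nonsingular b} {S : Set ℂ} (hS : S.Countable)
    (hbS : b ∉ S) {M : LinearMap.GeneralLinearGroup ℂ (P.solutions b)}
    (hM : M ∈ P.monodromyGroup hb) :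
    ∃ γ : Path b b, (∀ s, γ s ∉ S) ∧ IsMonodromyAlong M γ := by
  obtain ⟨γ, -, hγ⟩ := hM
  obtain ⟨δ, hδ, hδM⟩ := exists_continuesAlong_avoiding hS hbS hbS fun i => hγ (e i)
  refine ⟨δ, hδ, fun y => ?_⟩
  have := Fintype.ofFinite ι
  have h := ContinuesAlong.sum Finset.univ fun i => (hδM i).const_smul (e.repr y i)
  have e1 : (y : Germ (𝓝 b) ℂ) = ∑ i, e.repr y i • (e i : Germ (𝓝 b) ℂ) := by
    refine (congrArg (P.solutions b).subtype (e.sum_repr y)).symm.trans ?_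
    simp only [map_sum, map_smul, Submodule.subtype_apply]
  have e2 : (M.1 y : Germ (𝓝 b) ℂ) = ∑ i, e.repr y i • (M.1 (e i) : Germ (𝓝 b) ℂ) := by
    refine (congrArg (fun y => (P.solutions b).subtype (M.1 y)) (e.sum_repr y)).symm.trans ?_
    simp only [map_sum, map_smul, Submodule.subtype_apply]
  rw [e1, e2]
  exact h

theorem ne_zero_of_continuesAlong_smul {f : ℂ → ℂ} (hfb : f b ≠ 0) {γ : Path b b} {χ : ℂ}
    (h : ContinuesAlong γ (f : Germ (𝓝 b) ℂ) (χ • (f : Germ (𝓝 b) ℂ))) : χ ≠ 0 := by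
  rintro rfl
  rw [zero_smul] at h
  exact hfb (Germ.coe_eq.1 h.symm.eq_zero).self_of_nhds

/-- Along a path along which `f` is multiplied by `χ`, the monodromy of the shift is `χ` times the
monodromy. -/
theorem IsMonodromyAlong.exists_shift {φ : P.solutions b ≃ₗ[ℂ] Q.solutions b} {f : ℂ → ℂ}
    (hφ : IsMulBy φ f) (hfb : f b ≠ 0) {M : LinearMap.GeneralLinearGroup ℂ (P.solutions b)}
    {γ : Path b b} (hM : IsMonodromyAlong M γ) {χ : ℂ}
    (hχ : ContinuesAlong γ (f : Germ (𝓝 b) ℂ) (χ • (f : Germ (𝓝 b) ℂ))) :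
    ∃ N : LinearMap.GeneralLinearGroup ℂ (Q.solutions b), IsMonodromyAlong N γ ∧
      ∀ y, N.1 (φ y) = χ • φ (M.1 y) := by
  have hχ0 := ne_zero_of_continuesAlong_smul hfb hχ
  have e1 : ∀ y, M.1 ((M⁻¹).1 y) = y := fun y => by
    rw [← Module.End.mul_apply, Units.mul_inv, Module.End.one_apply]
  have e2 : ∀ y, (M⁻¹).1 (M.1 y) = y := fun y => by
    rw [← Module.End.mul_apply, Units.inv_mul, Module.End.one_apply]
  refine ⟨⟨χ • (φ.toLinearMap ∘ₗ M.1 ∘ₗ φ.symm.toLinearMap),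
    χ⁻¹ • (φ.toLinearMap ∘ₗ (M⁻¹).1 ∘ₗ φ.symm.toLinearMap), ?_, ?_⟩, fun z => ?_, fun y => ?_⟩
  · refine LinearMap.ext fun z => ?_
    simp [e1, hχ0, smul_smul]
  · refine LinearMap.ext fun z => ?_
    simp [e2, hχ0, smul_smul]
  · have h := hχ.mul (hM (φ.symm z))
    rw [← hφ, LinearEquiv.apply_symm_apply, germ_smul_mul, ← hφ] at h
    exact h
  · simp

end DiffOp

/-! ### Matrices -/

section Matrices

open Matrix DiffOp

variable {P Q : DiffOp 4} {b : ℂ}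

theorem mem_monodromyMatrices {hb : P.Nonsingular b}
    {e : Module.Basis (Fin 2 ⊕ Fin 2) ℂ (P.solutions b)} {g : GL4} :
    g ∈ P.monodromyMatrices hb e ↔
      ∃ M ∈ P.monodromyGroup hb, g.1 = LinearMap.toMatrix e e M.1 := by
  constructor
  · rintro ⟨M, hM, rfl⟩
    exact ⟨M, hM, rfl⟩
  · rintro ⟨M, hM, h⟩
    exact ⟨M, hM, Units.ext h.symm⟩

theorem mem_symplecticGroup_of_mem_Sp4Z {g : GL4} (hg : g ∈ Sp4Z) :
    g.1 ∈ symplecticGroup (Fin 2) ℂ := by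
  obtain ⟨A, rfl⟩ := hg
  exact SymplecticGroup.map_mem A.2 (Int.castRingHom ℂ)

theorem neg_mem_Sp4Z {g : GL4} (hg : g ∈ Sp4Z) : -g ∈ Sp4Z := by
  obtain ⟨A, rfl⟩ := hg
  refine ⟨⟨-A.1, SymplecticGroup.neg_mem A.2⟩, Units.ext ?_⟩
  ext i j
  simp

/-- The groups agree up to signs. -/
def LeUpToSign (G G' : Subgroup GL4) : Prop := ∀ g ∈ G, g ∈ G' ∨ -g ∈ G'

theorem LeUpToSign.le_Sp4Z {G G' : Subgroup GL4} (h : LeUpToSign G G') (hG' : G' ≤ Sp4Z) :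
    G ≤ Sp4Z := fun g hg => by
  rcases h g hg with h | h
  · exact hG' h
  · have := neg_mem_Sp4Z (hG' h)
    rwa [neg_neg] at this

/-- If `p` vanishes on `G'`, then `p(A) p(-A)` vanishes on `G`, hence on `Sp(4, ℂ)`. By
irreducibility one factor vanishes there, and `Sp(4, ℂ)` is stable under negation. -/
theorem IsZariskiDenseInSp4Z.of_leUpToSign {G G' : Subgroup GL4} (h : LeUpToSign G G')
    (h' : LeUpToSign G' G) (hG : IsZariskiDenseInSp4Z G) : IsZariskiDenseInSp4Z G' := by
  refine ⟨h'.le_Sp4Z hG.1, fun p hp => ?_⟩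
  let q : MvPolynomial ((Fin 2 ⊕ Fin 2) × (Fin 2 ⊕ Fin 2)) ℂ :=
    MvPolynomial.aeval (fun ij => -MvPolynomial.X ij) p
  have hq : ∀ A : Matrix (Fin 2 ⊕ Fin 2) (Fin 2 ⊕ Fin 2) ℂ,
      MvPolynomial.eval (fun ij => A ij.1 ij.2) q =
        MvPolynomial.eval (fun ij => (-A) ij.1 ij.2) p := by
    intro A
    simp only [q, MvPolynomial.aeval_def, MvPolynomial.hom_eval₂]
    rw [MvPolynomial.eval]
    congr 1
    · ext x
      simp
    · ext x
      simp
  have hpq : p * q ∈ symplecticIdeal := by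
    rw [mem_symplecticIdeal]
    refine hG.2 _ fun g hg => ?_
    rw [map_mul, hq]
    rcases h g hg with h1 | h1
    · rw [hp g h1, zero_mul]
    · have := hp _ h1
      rw [Units.val_neg] at this
      rw [this, mul_zero]
  rcases symplecticIdeal_isPrime.mem_or_mem hpq with h1 | h1
  · exact mem_symplecticIdeal.1 h1
  · intro A hA
    have := mem_symplecticIdeal.1 h1 _ (SymplecticGroup.neg_mem hA)
    rwa [hq, neg_neg] at this

theorem IsArithmeticInSp4Z.of_leUpToSign {G G' : Subgroup GL4} (h : LeUpToSign G G')
    (h' : LeUpToSign G' G) (hG : IsArithmeticInSp4Z G) : IsArithmeticInSp4Z G' := by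
  have hG' := h'.le_Sp4Z hG.1
  refine ⟨hG', ?_⟩
  -- `K` is `G'` together with its negatives. It contains `G`, so it has finite index, and `G'` has
  -- index 1 or 2 in it according to whether `-1` lies in `G'`.
  let K : Subgroup GL4 :=
    { carrier := {g | g ∈ G' ∨ -g ∈ G'}
      one_mem' := Or.inl (one_mem _)
      mul_mem' := by
        rintro x y (hx | hx) (hy | hy)
        · exact Or.inl (mul_mem hx hy)
        · right; rw [← mul_neg]; exact mul_mem hx hy
        · right; rw [← neg_mul]; exact mul_mem hx hy
        · left; rw [← neg_mul_neg]; exact mul_mem hx hy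
      inv_mem' := by
        rintro x (hx | hx)
        · exact Or.inl (inv_mem hx)
        · right; rw [← inv_neg]; exact inv_mem hx }
  have hGK : G ≤ K := h
  have hG'K : G' ≤ K := fun g hg => Or.inl hg
  have hK : K.relIndex Sp4Z ≠ 0 := fun h0 =>
    hG.2.relIndex_ne_zero (Subgroup.relIndex_eq_zero_of_le_left hGK h0)
  have hG'K' : G'.relIndex K ≠ 0 := by
    by_cases hneg : (-1 : GL4) ∈ G'
    · have : K ≤ G' := by
        rintro g (hg | hg)
        · exact hg
        · have := mul_mem hneg hg
          rwa [neg_mul_neg, one_mul] at this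
      rw [Subgroup.relIndex_eq_one.2 this]
      exact one_ne_zero
    · have : G'.relIndex K = 2 := by
        rw [Subgroup.relIndex_eq_two_iff_exists_notMem_and]
        refine ⟨-1, Or.inr (by rw [neg_neg]; exact one_mem _), hneg, ?_⟩
        rintro g (hg | hg)
        · exact Or.inr hg
        · left; rwa [mul_neg, mul_one]
      rw [this]
      exact two_ne_zero
  exact ⟨Subgroup.relIndex_ne_zero_trans hG'K' hK⟩

end Matrices

/-! ### Comparison of the monodromy groups of an operator and of its shift. -/

section Comparison

open Matrix DiffOp

variable {P Q : DiffOp 4} {b : ℂ} {f : ℂ → ℂ}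

/-- The points to be avoided by loops: the singular points of `P` and `Q` and the points of `A`. -/
def badSet (P Q : DiffOp 4) (A : Finset ℂ) : Set ℂ :=
  {t | ¬ P.Nonsingular t} ∪ {t | ¬ Q.Nonsingular t} ∪ A

theorem finite_badSet (P Q : DiffOp 4) (A : Finset ℂ) : (badSet P Q A).Finite :=
  (P.finite_singular.union Q.finite_singular).union A.finite_toSet

theorem notMem_badSet {A : Finset ℂ} {t : ℂ} :
    t ∉ badSet P Q A ↔ P.Nonsingular t ∧ Q.Nonsingular t ∧ t ∉ A := by
  simp [badSet, and_assoc]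

/-- In the basis transported by `φ`, the matrix for the shift is `χ` times the original matrix along
the same loop, and `χ` is a sign. -/
theorem leUpToSign_monodromyMatrices {φ : P.solutions b ≃ₗ[ℂ] Q.solutions b}
    (hφ : IsMulBy φ f) (hfb : f b ≠ 0) {hP : P.Nonsingular b} {hQ : Q.Nonsingular b}
    (e : Module.Basis (Fin 2 ⊕ Fin 2) ℂ (P.solutions b)) {S : Set ℂ} (hS : S.Countable)
    (hbS : b ∉ S) (hSQ : ∀ t ∉ S, Q.Nonsingular t)
    (hsign : ∀ γ : Path b b, (∀ s, γ s ∉ S) → ∃ χ : ℂ, χ ^ 2 = 1 ∧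
      ContinuesAlong γ (f : Germ (𝓝 b) ℂ) (χ • (f : Germ (𝓝 b) ℂ))) :
    LeUpToSign (P.monodromyMatrices hP e) (Q.monodromyMatrices hQ (e.map φ)) := by
  intro g hg
  obtain ⟨M, hM, hgM⟩ := mem_monodromyMatrices.1 hg
  obtain ⟨γ, hγ, hMγ⟩ := exists_isMonodromyAlong_avoiding e hS hbS hM
  obtain ⟨χ, hχ1, hχ⟩ := hsign γ hγ
  obtain ⟨N, hN, hNφ⟩ := hMγ.exists_shift hφ hfb hχ
  have hmat : LinearMap.toMatrix (e.map φ) (e.map φ) N.1 = χ • g.1 := by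
    rw [hgM]
    ext i j
    simp [LinearMap.toMatrix_apply, hNφ]
  have hNmem := mem_monodromyGroup_of_isMonodromyAlong hQ hN fun s => hSQ _ (hγ s)
  rcases (sq_eq_sq_iff_eq_or_eq_neg.1 (hχ1.trans (one_pow 2).symm)) with rfl | rfl
  · left
    exact mem_monodromyMatrices.2 ⟨N, hNmem, by rw [hmat, one_smul]⟩
  · right
    exact mem_monodromyMatrices.2 ⟨N, hNmem, by rw [hmat, Units.val_neg, neg_smul, one_smul]⟩

theorem HasLogDeriv.exists_sign {A : Finset ℂ} {α : ℂ → ℂ} (hf : HasLogDeriv f b A α)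
    {r : RatFunc ℂ} (hr : ∀ᶠ t in 𝓝 b, f t ^ 2 = ratVal r t)
    (hrA : ∀ t ∉ A, r.denom.eval t ≠ 0) {γ : Path b b} (hγ : ∀ s, γ s ∉ A) :
    ∃ χ : ℂ, χ ^ 2 = 1 ∧ ContinuesAlong γ (f : Germ (𝓝 b) ℂ) (χ • (f : Germ (𝓝 b) ℂ)) := by
  obtain ⟨χ, hχ⟩ := hf.exists_continuesAlong hγ
  exact ⟨χ, hf.sq_eq_one_of_continuesAlong hr (fun s => hrA _ (hγ s)) hχ, hχ⟩

theorem HasLogDeriv.exists_sign_inv {A : Finset ℂ} {α : ℂ → ℂ} (hf : HasLogDeriv f b A α)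
    {r : RatFunc ℂ} (hr : ∀ᶠ t in 𝓝 b, f t ^ 2 = ratVal r t)
    (hrA : ∀ t ∉ A, r.denom.eval t ≠ 0) {γ : Path b b} (hγ : ∀ s, γ s ∉ A) :
    ∃ χ : ℂ, χ ^ 2 = 1 ∧ ContinuesAlong γ ((f⁻¹ : ℂ → ℂ) : Germ (𝓝 b) ℂ)
      (χ • ((f⁻¹ : ℂ → ℂ) : Germ (𝓝 b) ℂ)) := by
  obtain ⟨χ, hχ1, hχ⟩ := hf.exists_sign hr hrA hγ
  obtain ⟨χ', hχ'⟩ := hf.inv.exists_continuesAlong hγ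
  refine ⟨χ', ?_, hχ'⟩
  have hone : ((f⁻¹ : ℂ → ℂ) : Germ (𝓝 b) ℂ) * (f : Germ (𝓝 b) ℂ) = 1 := by
    simpa using germ_inv_mul_cancel hf.analyticAt hf.ne_zero 1
  have h1 := hχ'.mul hχ
  rw [germ_smul_mul, germ_mul_smul, hone] at h1
  have h2 : ContinuesAlong γ (1 : Germ (𝓝 b) ℂ) 1 :=
    (IsContinuation.of_analyticAt (k := 1) fun _ => analyticAt_const).continuesAlong
  have h3 := h1.unique h2
  have h4 : χ' • χ • (1 : ℂ → ℂ) =ᶠ[𝓝 b] 1 := Germ.coe_eq.1 h3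
  have h5 : χ' * χ = 1 := by simpa using h4.self_of_nhds
  have h6 : (χ' * χ) ^ 2 = 1 := by rw [h5, one_pow]
  rwa [mul_pow, hχ1, mul_one] at h6

theorem leUpToSign_of_sq_rational {φ : P.solutions b ≃ₗ[ℂ] Q.solutions b} (hφ : IsMulBy φ f)
    (hP : P.Nonsingular b) (hQ : Q.Nonsingular b) (hf : AnalyticAt ℂ f b) (hfb : f b ≠ 0)
    (hr : IsRationalAt b (fun t => f t ^ 2))
    (e : Module.Basis (Fin 2 ⊕ Fin 2) ℂ (P.solutions b)) :
    LeUpToSign (P.monodromyMatrices hP e) (Q.monodromyMatrices hQ (e.map φ)) ∧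
      LeUpToSign (Q.monodromyMatrices hQ (e.map φ)) (P.monodromyMatrices hP e) := by
  obtain ⟨r, hr⟩ := hr
  obtain ⟨A, α, hlog, hrA⟩ := exists_hasLogDeriv hf hfb one_le_two hr
  have hS := (finite_badSet P Q A).countable
  have hbS : b ∉ badSet P Q A := notMem_badSet.2 ⟨hP, hQ, hlog.notMem⟩
  refine ⟨leUpToSign_monodromyMatrices hφ hfb e hS hbS (fun t ht => (notMem_badSet.1 ht).2.1)
    fun γ hγ => hlog.exists_sign hr hrA fun s => (notMem_badSet.1 (hγ s)).2.2, ?_⟩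
  have h := leUpToSign_monodromyMatrices (hφ.symm hf hfb) (hP := hQ) (hQ := hP)
    (inv_ne_zero hfb) (e.map φ) hS hbS (fun t ht => (notMem_badSet.1 ht).1)
    fun γ hγ => hlog.exists_sign_inv hr hrA fun s => (notMem_badSet.1 (hγ s)).2.2
  have he : (e.map φ).map φ.symm = e := by
    ext i
    simp
  rwa [he] at h

/-- The polynomial whose value at `A` is the entry `(i, j)` of `A * K * Aᵀ`. -/
def congrEntry (K : Matrix (Fin 2 ⊕ Fin 2) (Fin 2 ⊕ Fin 2) ℂ) (i j : Fin 2 ⊕ Fin 2) :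
    MvPolynomial ((Fin 2 ⊕ Fin 2) × (Fin 2 ⊕ Fin 2)) ℂ :=
  ∑ l, (∑ k, MvPolynomial.X (i, k) * MvPolynomial.C (K k l)) * MvPolynomial.X (j, l)

theorem eval_congrEntry (K A : Matrix (Fin 2 ⊕ Fin 2) (Fin 2 ⊕ Fin 2) ℂ) (i j : Fin 2 ⊕ Fin 2) :
    MvPolynomial.eval (fun ij => A ij.1 ij.2) (congrEntry K i j) = (A * K * Aᵀ) i j := by
  simp [congrEntry, Matrix.mul_apply]

/-- Here `k = ψ h m h⁻¹` with `k` and `m` symplectic. Determinants, both equal to 1, give `ψ⁴ = 1`;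
conjugating the relation `k J kᵀ = J` back by `h` gives the identity for the transported form. -/
theorem symplectic_semiconj {m k h h' : Matrix (Fin 2 ⊕ Fin 2) (Fin 2 ⊕ Fin 2) ℂ} {ψ : ℂ}
    (hh' : h * h' = 1) (hm : m ∈ symplecticGroup (Fin 2) ℂ) (hk : k ∈ symplecticGroup (Fin 2) ℂ)
    (hcomm : k * h = ψ • (h * m)) :
    ψ ^ 4 = 1 ∧ ψ ^ 2 • (m * (h' * J (Fin 2) ℂ * h'ᵀ) * mᵀ) = h' * J (Fin 2) ℂ * h'ᵀ := by
  have h'h : h' * h = 1 := mul_eq_one_comm.1 hh'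
  have hk' : k = ψ • (h * m * h') := by
    calc k = k * h * h' := by rw [Matrix.mul_assoc, hh', mul_one]
      _ = _ := by rw [hcomm, Matrix.smul_mul]
  constructor
  · have hd := congrArg det hk'
    rw [SymplecticGroup.det_eq_one hk, det_smul, det_mul, det_mul,
      SymplecticGroup.det_eq_one hm, mul_one, ← det_mul, hh', det_one, mul_one] at hd
    simpa using hd.symm
  · have hs := SymplecticGroup.mem_iff.1 hk
    calc ψ ^ 2 • (m * (h' * J (Fin 2) ℂ * h'ᵀ) * mᵀ)
        = (h' * h) * (ψ ^ 2 • (m * (h' * J (Fin 2) ℂ * h'ᵀ) * mᵀ)) * (hᵀ * h'ᵀ) := by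
          rw [← transpose_mul, h'h, transpose_one, one_mul, mul_one]
      _ = h' * (k * J (Fin 2) ℂ * kᵀ) * h'ᵀ := by
          rw [hk']
          simp only [transpose_smul, transpose_mul, Matrix.smul_mul, Matrix.mul_smul,
            smul_smul, Matrix.mul_assoc, pow_two]
      _ = h' * J (Fin 2) ℂ * h'ᵀ := by rw [hs]

theorem congr_J_ne_zero {h h' : Matrix (Fin 2 ⊕ Fin 2) (Fin 2 ⊕ Fin 2) ℂ} (hh' : h * h' = 1) :
    h' * J (Fin 2) ℂ * h'ᵀ ≠ 0 := by
  intro h0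
  have hu : IsUnit (det h') := isUnit_det_of_left_inverse hh'
  have := (hu.mul (isUnit_det_J (Fin 2) ℂ)).mul hu
  rw [← det_mul, ← det_transpose h', ← det_mul, h0, det_zero] at this
  exact not_isUnit_zero this

theorem toMatrix_shift_comm {φ : P.solutions b ≃ₗ[ℂ] Q.solutions b}
    (e : Module.Basis (Fin 2 ⊕ Fin 2) ℂ (P.solutions b))
    (e' : Module.Basis (Fin 2 ⊕ Fin 2) ℂ (Q.solutions b))
    {M : P.solutions b →ₗ[ℂ] P.solutions b} {N : Q.solutions b →ₗ[ℂ] Q.solutions b} {ψ : ℂ}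
    (h : ∀ y, N (φ y) = ψ • φ (M y)) :
    LinearMap.toMatrix e' e' N * LinearMap.toMatrix e e' φ.toLinearMap =
      ψ • (LinearMap.toMatrix e e' φ.toLinearMap * LinearMap.toMatrix e e M) := by
  rw [← LinearMap.toMatrix_comp, ← LinearMap.toMatrix_comp, ← map_smul]
  congr 1
  exact LinearMap.ext h

theorem toMatrix_mem_symplecticGroup {hb : P.Nonsingular b}
    {e : Module.Basis (Fin 2 ⊕ Fin 2) ℂ (P.solutions b)} (he : P.monodromyMatrices hb e ≤ Sp4Z)
    {M : LinearMap.GeneralLinearGroup ℂ (P.solutions b)} (hM : M ∈ P.monodromyGroup hb) :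
    LinearMap.toMatrix e e M.1 ∈ symplecticGroup (Fin 2) ℂ := by
  obtain ⟨g, hg⟩ : ∃ g : GL4, g.1 = LinearMap.toMatrix e e M.1 :=
    ⟨Units.map (LinearMap.toMatrixAlgEquiv e).toMulEquiv.toMonoidHom M, rfl⟩
  rw [← hg]
  exact mem_symplecticGroup_of_mem_Sp4Z (he (mem_monodromyMatrices.2 ⟨M, hM, hg⟩))

/-- `K` is the symplectic form of `Q` in the basis chosen for `P`. It is fixed before the loop, so
one matrix serves for all loops. -/
theorem exists_congr_form {φ : P.solutions b ≃ₗ[ℂ] Q.solutions b} (hφ : IsMulBy φ f)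
    (hfb : f b ≠ 0) {hP : P.Nonsingular b} {hQ : Q.Nonsingular b} {A : Finset ℂ}
    {e : Module.Basis (Fin 2 ⊕ Fin 2) ℂ (P.solutions b)} (he : P.monodromyMatrices hP e ≤ Sp4Z)
    {e' : Module.Basis (Fin 2 ⊕ Fin 2) ℂ (Q.solutions b)}
    (he' : Q.monodromyMatrices hQ e' ≤ Sp4Z) :
    ∃ K : Matrix (Fin 2 ⊕ Fin 2) (Fin 2 ⊕ Fin 2) ℂ, K ≠ 0 ∧
      ∀ (δ : Path b b), (∀ s, δ s ∉ badSet P Q A) → ∀ (ψ : ℂ),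
      ContinuesAlong δ (f : Germ (𝓝 b) ℂ) (ψ • (f : Germ (𝓝 b) ℂ)) →
      ∀ M : LinearMap.GeneralLinearGroup ℂ (P.solutions b), IsMonodromyAlong M δ →
      LinearMap.toMatrix e e M.1 ∈ symplecticGroup (Fin 2) ℂ ∧ ψ ^ 4 = 1 ∧
      ψ ^ 2 • (LinearMap.toMatrix e e M.1 * K * (LinearMap.toMatrix e e M.1)ᵀ) = K := by
  have hh' : LinearMap.toMatrix e e' φ.toLinearMap *
      LinearMap.toMatrix e' e φ.symm.toLinearMap = 1 := by
    rw [← LinearMap.toMatrix_comp, LinearEquiv.comp_symm, LinearMap.toMatrix_id]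
  refine ⟨_, congr_J_ne_zero hh', fun δ hδ ψ hψ M hM => ?_⟩
  obtain ⟨N, hN, hNφ⟩ := hM.exists_shift hφ hfb hψ
  have hMmem := mem_monodromyGroup_of_isMonodromyAlong hP hM fun s => (notMem_badSet.1 (hδ s)).1
  have hNmem := mem_monodromyGroup_of_isMonodromyAlong hQ hN fun s =>
    (notMem_badSet.1 (hδ s)).2.1
  have hmM : LinearMap.toMatrix e e M.1 ∈ symplecticGroup (Fin 2) ℂ :=
    toMatrix_mem_symplecticGroup he hMmem
  have hmN : LinearMap.toMatrix e' e' N.1 ∈ symplecticGroup (Fin 2) ℂ :=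
    toMatrix_mem_symplecticGroup he' hNmem
  exact ⟨hmM, symplectic_semiconj hh' hmM hmN (toMatrix_shift_comm e e' hNφ)⟩

/-- If the shift of a symplectic operator is symplectic, then `f` is multiplied by `±1` along all
loops. -/
theorem sq_eq_one_of_dense {φ : P.solutions b ≃ₗ[ℂ] Q.solutions b} (hφ : IsMulBy φ f)
    {hP : P.Nonsingular b} {hQ : Q.Nonsingular b} {A : Finset ℂ} {α : ℂ → ℂ}
    (hf : HasLogDeriv f b A α) {e : Module.Basis (Fin 2 ⊕ Fin 2) ℂ (P.solutions b)}
    (he : IsZariskiDenseInSp4Z (P.monodromyMatrices hP e))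
    {e' : Module.Basis (Fin 2 ⊕ Fin 2) ℂ (Q.solutions b)}
    (he' : Q.monodromyMatrices hQ e' ≤ Sp4Z) {γ : Path b b} (hγ : ∀ s, γ s ∉ badSet P Q A) {χ : ℂ}
    (hχ : ContinuesAlong γ (f : Germ (𝓝 b) ℂ) (χ • (f : Germ (𝓝 b) ℂ))) : χ ^ 2 = 1 := by
  have hbS : b ∉ badSet P Q A := notMem_badSet.2 ⟨hP, hQ, hf.notMem⟩
  obtain ⟨K, hK0, key⟩ := exists_congr_form hφ hf.ne_zero (A := A) he.1 he'
  obtain ⟨i, j, hij⟩ : ∃ i j, K i j ≠ 0 := by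
    by_contra! H
    exact hK0 (Matrix.ext H)
  -- From `ψ² x = κ` and `ψ⁴ = 1` follows `x² = κ²`, a relation free of `ψ`, hence polynomial in the
  -- matrix, to which density applies.
  have hprod : (congrEntry K i j - MvPolynomial.C (K i j)) *
      (congrEntry K i j + MvPolynomial.C (K i j)) ∈ symplecticIdeal := by
    rw [mem_symplecticIdeal]
    refine he.2 _ fun g hg => ?_
    obtain ⟨M, hM, hgM⟩ := mem_monodromyMatrices.1 hg
    obtain ⟨δ, hδ, hMδ⟩ := exists_isMonodromyAlong_avoiding e
      (finite_badSet P Q A).countable hbS hM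
    obtain ⟨ψ, hψ⟩ := hf.exists_continuesAlong fun s => (notMem_badSet.1 (hδ s)).2.2
    obtain ⟨-, h4, hK⟩ := key δ hδ ψ hψ M hMδ
    have hent := congrFun (congrFun hK i) j
    rw [Matrix.smul_apply, smul_eq_mul, ← hgM] at hent
    rw [map_mul, map_sub, map_add, eval_congrEntry, MvPolynomial.eval_C]
    linear_combination -(g.1 * K * g.1ᵀ) i j ^ 2 * h4 +
      (ψ ^ 2 * (g.1 * K * g.1ᵀ) i j + K i j) * hent
  have hmem : congrEntry K i j - MvPolynomial.C (K i j) ∈ symplecticIdeal := by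
    rcases symplecticIdeal_isPrime.mem_or_mem hprod with h1 | h1
    · exact h1
    -- At the identity the factor `x + κ` equals `2 κ ≠ 0`.
    · have := mem_symplecticIdeal.1 h1 1 (one_mem _)
      rw [map_add, eval_congrEntry, MvPolynomial.eval_C, one_mul, transpose_one, mul_one,
        ← two_mul] at this
      exact absurd this (mul_ne_zero two_ne_zero hij)
  -- Along the given loop `x = κ` as well, so `χ² κ = κ`.
  obtain ⟨M, hM⟩ := P.exists_isMonodromyAlong (by norm_num : 0 < 4)
    fun s => (notMem_badSet.1 (hγ s)).1
  obtain ⟨hmM, -, hK⟩ := key γ hγ χ hχ M hM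
  have hent := congrFun (congrFun hK i) j
  have h1 := mem_symplecticIdeal.1 hmem _ hmM
  rw [map_sub, eval_congrEntry, MvPolynomial.eval_C, sub_eq_zero] at h1
  rw [Matrix.smul_apply, h1, smul_eq_mul] at hent
  exact mul_right_cancel₀ hij (hent.trans (one_mul _).symm)

theorem isRationalAt_sq_of_dense {φ : P.solutions b ≃ₗ[ℂ] Q.solutions b} (hφ : IsMulBy φ f)
    {hP : P.Nonsingular b} {hQ : Q.Nonsingular b} (hf : AnalyticAt ℂ f b) (hfb : f b ≠ 0)
    {n : ℕ} (hn : 1 ≤ n) (hr : IsRationalAt b (fun t => f t ^ n))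
    {e : Module.Basis (Fin 2 ⊕ Fin 2) ℂ (P.solutions b)}
    (he : IsZariskiDenseInSp4Z (P.monodromyMatrices hP e))
    {e' : Module.Basis (Fin 2 ⊕ Fin 2) ℂ (Q.solutions b)}
    (he' : Q.monodromyMatrices hQ e' ≤ Sp4Z) : IsRationalAt b (fun t => f t ^ 2) := by
  obtain ⟨r, hr⟩ := hr
  obtain ⟨A, α, hlog, -⟩ := exists_hasLogDeriv hf hfb hn hr
  refine hlog.isRationalAt_sq fun a ha => ?_
  obtain ⟨γ, hγ, hχ⟩ := hlog.exists_loop (finite_badSet P Q A) Set.subset_union_right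
    (notMem_badSet.2 ⟨hP, hQ, hlog.notMem⟩) ha
  exact sq_eq_one_of_dense hφ hlog he he' hγ hχ

end Comparison

/-! ### Pole orders of rational functions -/

section PoleOrder

open Polynomial

/-- The rational function `p / q`. -/
def quot (p q : ℂ[X]) : RatFunc ℂ := algebraMap _ (RatFunc ℂ) p / algebraMap _ (RatFunc ℂ) q

theorem quot_add {p q p' q' : ℂ[X]} (hq : q ≠ 0) (hq' : q' ≠ 0) :
    quot p q + quot p' q' = quot (p * q' + q * p') (q * q') := by
  rw [quot, quot, quot, div_add_div _ _ (RatFunc.algebraMap_ne_zero hq)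
    (RatFunc.algebraMap_ne_zero hq'), map_add, map_mul, map_mul, map_mul]

theorem quot_mul (p q p' q' : ℂ[X]) : quot p q * quot p' q' = quot (p * p') (q * q') := by
  rw [quot, quot, quot, div_mul_div_comm, map_mul, map_mul]

theorem quot_num_denom (r : RatFunc ℂ) : quot r.num r.denom = r := RatFunc.num_div_denom r

theorem quot_mul_mul_right {p q c : ℂ[X]} (hc : c ≠ 0) :
    quot (p * c) (q * c) = quot p q := by
  rw [quot, quot, map_mul, map_mul, mul_div_mul_right _ _ (RatFunc.algebraMap_ne_zero hc)]

/-- `r` is regular at `t`, with value `v`. -/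
def HasValue (r : RatFunc ℂ) (t v : ℂ) : Prop := r.denom.eval t ≠ 0 ∧ ratVal r t = v

theorem ne_zero_of_eval_ne_zero {q : ℂ[X]} {t : ℂ} (hq : q.eval t ≠ 0) : q ≠ 0 := by
  rintro rfl
  simp at hq

theorem hasValue_iff {r : RatFunc ℂ} {t v : ℂ} :
    HasValue r t v ↔ ∃ p q : ℂ[X], q.eval t ≠ 0 ∧ r = quot p q ∧ v = p.eval t / q.eval t := by
  constructor
  · rintro ⟨h1, h2⟩
    exact ⟨r.num, r.denom, h1, (quot_num_denom r).symm, by rw [← h2, ratVal_eq]⟩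
  · rintro ⟨p, q, hq, rfl, rfl⟩
    exact ⟨denom_eval_ne_zero_of_div hq, ratVal_div hq⟩

theorem hasValue_quot {p q : ℂ[X]} {t : ℂ} (hq : q.eval t ≠ 0) :
    HasValue (quot p q) t (p.eval t / q.eval t) := hasValue_iff.2 ⟨p, q, hq, rfl, rfl⟩

namespace HasValue

variable {r s : RatFunc ℂ} {t v w : ℂ}

theorem add (hr : HasValue r t v) (hs : HasValue s t w) : HasValue (r + s) t (v + w) := by
  obtain ⟨p, q, hq, rfl, rfl⟩ := hasValue_iff.1 hr
  obtain ⟨p', q', hq', rfl, rfl⟩ := hasValue_iff.1 hs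
  rw [quot_add (ne_zero_of_eval_ne_zero hq) (ne_zero_of_eval_ne_zero hq'), div_add_div _ _ hq hq']
  convert hasValue_quot (p := p * q' + q * p') (q := q * q') (t := t) ?_ using 1
  · simp
  · simpa using ⟨hq, hq'⟩

theorem mul (hr : HasValue r t v) (hs : HasValue s t w) : HasValue (r * s) t (v * w) := by
  obtain ⟨p, q, hq, rfl, rfl⟩ := hasValue_iff.1 hr
  obtain ⟨p', q', hq', rfl, rfl⟩ := hasValue_iff.1 hs
  rw [quot_mul, div_mul_div_comm]
  convert hasValue_quot (p := p * p') (q := q * q') (t := t) ?_ using 1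
  · simp
  · simpa using ⟨hq, hq'⟩

theorem natCast (k : ℕ) : HasValue (k : RatFunc ℂ) t k := by
  refine hasValue_iff.2 ⟨k, 1, by simp, ?_, by simp⟩
  rw [quot, map_natCast, map_one, div_one]

theorem sum {ι : Type*} (I : Finset ι) {r : ι → RatFunc ℂ} {v : ι → ℂ}
    (h : ∀ i, HasValue (r i) t (v i)) : HasValue (∑ i ∈ I, r i) t (∑ i ∈ I, v i) := by
  classical
  induction I using Finset.induction_on with
  | empty => simpa using natCast 0
  | insert i I hi ih =>
    rw [Finset.sum_insert hi, Finset.sum_insert hi]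
    exact (h i).add ih

end HasValue

/-- After clearing denominators, two polynomials agree on a neighbourhood, which is infinite. -/
theorem eq_of_eventually_ratVal_eq {r s : RatFunc ℂ} {b : ℂ}
    (hr : r.denom.eval b ≠ 0) (hs : s.denom.eval b ≠ 0)
    (h : ∀ᶠ t in 𝓝 b, ratVal r t = ratVal s t) : r = s := by
  have hinf : {t | r.num.eval t * s.denom.eval t = s.num.eval t * r.denom.eval t}.Infinite := by
    refine infinite_of_mem_nhds b ?_
    filter_upwards [h, r.denom.continuous.continuousAt.eventually_ne hr,
      s.denom.continuous.continuousAt.eventually_ne hs] with t h1 h2 h3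
    rw [ratVal_eq, ratVal_eq, div_eq_div_iff h2 h3] at h1
    exact h1
  have hpoly : r.num * s.denom = s.num * r.denom :=
    Polynomial.eq_of_infinite_eval_eq _ _ (hinf.mono fun t ht => by simpa using ht)
  rw [← quot_num_denom r, ← quot_num_denom s, quot, quot,
    div_eq_div_iff (RatFunc.algebraMap_ne_zero (RatFunc.denom_ne_zero _))
      (RatFunc.algebraMap_ne_zero (RatFunc.denom_ne_zero _)), ← map_mul, ← map_mul, hpoly]

/-- The order of the pole of `r` at `a` is at most `m`. -/
def PoleLE (a : ℂ) (m : ℕ) (r : RatFunc ℂ) : Prop :=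
  ∃ p q : ℂ[X], q.eval a ≠ 0 ∧ r = quot p (q * (X - C a) ^ m)

namespace PoleLE

variable {a : ℂ} {m k : ℕ} {r s : RatFunc ℂ}

theorem denominator_ne_zero {q : ℂ[X]} (hq : q.eval a ≠ 0) : q * (X - C a) ^ m ≠ 0 :=
  mul_ne_zero (ne_zero_of_eval_ne_zero hq) (pow_ne_zero _ (X_sub_C_ne_zero a))

theorem add (hr : PoleLE a m r) (hs : PoleLE a m s) : PoleLE a m (r + s) := by
  obtain ⟨p, q, hq, rfl⟩ := hr
  obtain ⟨p', q', hq', rfl⟩ := hs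
  refine ⟨p * q' + q * p', q * q', by simpa using ⟨hq, hq'⟩, ?_⟩
  rw [quot_add (denominator_ne_zero hq) (denominator_ne_zero hq'),
    ← quot_mul_mul_right (p := p * q' + q * p') (pow_ne_zero m (X_sub_C_ne_zero a))]
  congr 1 <;> ring

theorem mul (hr : PoleLE a m r) (hs : PoleLE a k s) : PoleLE a (m + k) (r * s) := by
  obtain ⟨p, q, hq, rfl⟩ := hr
  obtain ⟨p', q', hq', rfl⟩ := hs
  refine ⟨p * p', q * q', by simpa using ⟨hq, hq'⟩, ?_⟩
  rw [quot_mul]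
  congr 1
  ring

theorem mono (hr : PoleLE a m r) (h : m ≤ k) : PoleLE a k r := by
  obtain ⟨p, q, hq, rfl⟩ := hr
  obtain ⟨l, rfl⟩ := Nat.exists_eq_add_of_le h
  refine ⟨p * (X - C a) ^ l, q, hq, ?_⟩
  rw [pow_add, ← mul_assoc, quot_mul_mul_right (pow_ne_zero l (X_sub_C_ne_zero a))]

theorem natCast (l : ℕ) : PoleLE a m (l : RatFunc ℂ) := by
  refine mono (m := 0) ⟨l, 1, by simp, ?_⟩ (Nat.zero_le m)
  rw [quot, map_natCast, pow_zero, mul_one, map_one, div_one]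

theorem sum {ι : Type*} (I : Finset ι) {r : ι → RatFunc ℂ} (h : ∀ i, PoleLE a m (r i)) :
    PoleLE a m (∑ i ∈ I, r i) := by
  classical
  induction I using Finset.induction_on with
  | empty => simpa using natCast 0
  | insert i I hi ih =>
    rw [Finset.sum_insert hi]
    exact (h i).add ih

end PoleLE

theorem poleLE_iff {a : ℂ} {m : ℕ} {r : RatFunc ℂ} :
    PoleLE a m r ↔ r.denom.rootMultiplicity a ≤ m := by
  constructor
  · rintro ⟨p, q, hq, rfl⟩
    have h0 := PoleLE.denominator_ne_zero (m := m) hq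
    refine (rootMultiplicity_le_rootMultiplicity_of_dvd h0
      ((RatFunc.denom_dvd h0).2 ⟨p, rfl⟩) a).trans ?_
    rw [rootMultiplicity_mul h0, rootMultiplicity_X_sub_C_pow,
      rootMultiplicity_eq_zero (by simpa [IsRoot] using hq), zero_add]
  · intro h
    obtain ⟨q, hq, hq'⟩ := exists_eq_pow_rootMultiplicity_mul_and_not_dvd r.denom
      (RatFunc.denom_ne_zero r) a
    refine PoleLE.mono (m := r.denom.rootMultiplicity a) ⟨r.num, q, ?_, ?_⟩ h
    · rwa [dvd_iff_isRoot] at hq'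
    · rw [mul_comm, ← hq, quot_num_denom]

theorem poleLE_quot_logDen_pow (a : ℂ) (A : Finset ℂ) (p : ℂ[X]) (m : ℕ) :
    PoleLE a m (quot p (logDen A ^ m)) := by
  by_cases ha : a ∈ A
  · refine ⟨p, logDen (A.erase a) ^ m, ?_, ?_⟩
    · rw [eval_pow]
      exact pow_ne_zero _ (logDen_eval_ne_zero (by simp))
    · rw [← mul_pow, mul_comm (logDen _), logDen, logDen,
        Finset.mul_prod_erase _ (fun a => X - C a) ha]
  · refine PoleLE.mono (m := 0) ⟨p, logDen A ^ m, ?_, by simp⟩ (Nat.zero_le m)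
    rw [eval_pow]
    exact pow_ne_zero _ (logDen_eval_ne_zero ha)

/-- The rational function `r` vanishes at infinity to order at least `m`. -/
def VanishLE (m : ℕ) (r : RatFunc ℂ) : Prop :=
  ∃ p q : ℂ[X], q ≠ 0 ∧ r = quot p q ∧ (X ^ m * p).natDegree ≤ q.natDegree

namespace VanishLE

variable {m k : ℕ} {r s : RatFunc ℂ}

theorem add (hr : VanishLE m r) (hs : VanishLE m s) : VanishLE m (r + s) := by
  obtain ⟨p, q, hq, rfl, h⟩ := hr
  obtain ⟨p', q', hq', rfl, h'⟩ := hs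
  refine ⟨_, _, mul_ne_zero hq hq', quot_add hq hq', ?_⟩
  rw [natDegree_mul hq hq']
  have e : X ^ m * (p * q' + q * p') = (X ^ m * p) * q' + q * (X ^ m * p') := by ring
  rw [e]
  refine natDegree_add_le_of_le ?_ ?_ |>.trans (max_self _).le
  · exact natDegree_mul_le.trans (Nat.add_le_add_right h _)
  · exact natDegree_mul_le.trans (Nat.add_le_add_left h' _)

theorem mul (hr : VanishLE m r) (hs : VanishLE k s) : VanishLE (m + k) (r * s) := by
  obtain ⟨p, q, hq, rfl, h⟩ := hr
  obtain ⟨p', q', hq', rfl, h'⟩ := hs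
  refine ⟨_, _, mul_ne_zero hq hq', quot_mul _ _ _ _, ?_⟩
  rw [natDegree_mul hq hq']
  have e : X ^ (m + k) * (p * p') = (X ^ m * p) * (X ^ k * p') := by ring
  rw [e]
  exact natDegree_mul_le.trans (Nat.add_le_add h h')

theorem natCast (l : ℕ) : VanishLE 0 (l : RatFunc ℂ) := by
  refine ⟨l, 1, one_ne_zero, ?_, by simp⟩
  rw [quot, map_natCast, map_one, div_one]

theorem zero : VanishLE m 0 := ⟨0, 1, one_ne_zero, by simp [quot], by simp⟩

theorem sum {ι : Type*} (I : Finset ι) {r : ι → RatFunc ℂ} (h : ∀ i, VanishLE m (r i)) :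
    VanishLE m (∑ i ∈ I, r i) := by
  classical
  induction I using Finset.induction_on with
  | empty => simpa using zero
  | insert i I hi ih =>
    rw [Finset.sum_insert hi]
    exact (h i).add ih

end VanishLE

theorem vanishLE_iff {m : ℕ} {r : RatFunc ℂ} :
    VanishLE m r ↔ r = 0 ∨ r.intDegree ≤ -(m : ℤ) := by
  constructor
  · rintro ⟨p, q, hq, rfl, h⟩
    by_cases hp : p = 0
    · left; simp [quot, hp]
    · right
      rw [natDegree_X_pow_mul _ hp] at h
      rw [quot, div_eq_mul_inv, RatFunc.intDegree_mul (RatFunc.algebraMap_ne_zero hp)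
        (inv_ne_zero (RatFunc.algebraMap_ne_zero hq)), RatFunc.intDegree_inv,
        RatFunc.intDegree_polynomial, RatFunc.intDegree_polynomial]
      omega
  · rintro (rfl | h)
    · exact VanishLE.zero
    · refine ⟨r.num, r.denom, RatFunc.denom_ne_zero r, (quot_num_denom r).symm, ?_⟩
      refine natDegree_mul_le.trans ?_
      rw [natDegree_X_pow]
      rw [RatFunc.intDegree] at h
      omega

/-! ### Derivatives of functions with a logarithmic derivative with simple poles -/

/-- The polynomials `W m` with `u⁽ᵐ⁾ = W m / (∏ (t - a)) ^ m * u`. -/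
def derivNum (A : Finset ℂ) (α : ℂ → ℂ) : ℕ → ℂ[X]
  | 0 => 1
  | m + 1 => derivative (derivNum A α m) * logDen A
      - C (m : ℂ) * derivative (logDen A) * derivNum A α m + logNum A α * derivNum A α m

variable {A : Finset ℂ} {α : ℂ → ℂ} {b : ℂ} {u : ℂ → ℂ}

theorem HasLogDeriv.iteratedDeriv_eq (hu : HasLogDeriv u b A α) (m : ℕ) :
    ∀ᶠ t in 𝓝 b, iteratedDeriv m u t =
      (derivNum A α m).eval t / (logDen A ^ m).eval t * u t := by
  induction m with
  | zero => exact Eventually.of_forall fun t => by simp [derivNum]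
  | succ m ih =>
    filter_upwards [ih.eventually_nhds, hu.deriv_eq, hu.analyticAt.eventually_analyticAt,
      eventually_notMem_finset hu.notMem] with t h1 h2 h3 h4
    have hev : iteratedDeriv m u =ᶠ[𝓝 t] fun t =>
      (derivNum A α m).eval t / (logDen A ^ m).eval t * u t := h1
    have hR := logDen_eval_ne_zero h4
    have hRm : (logDen A ^ m).eval t ≠ 0 := by rw [eval_pow]; exact pow_ne_zero _ hR
    rw [← logNum_div_logDen h4] at h2
    rw [iteratedDeriv_succ, hev.deriv_eq]
    have hd := (((derivNum A α m).hasDerivAt t).fun_div ((logDen A ^ m).hasDerivAt t) hRm).mul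
      h3.differentiableAt.hasDerivAt
    rw [show deriv (fun t => (derivNum A α m).eval t / (logDen A ^ m).eval t * u t) t = _ from
      hd.deriv, h2]
    simp only [derivNum, eval_add, eval_sub, eval_mul, eval_pow, eval_C, derivative_pow]
    -- The derivative of `logDen A ^ m` has the truncated exponent `m - 1`, so `m = 0` is separate.
    cases m with
    | zero =>
      simp
      field_simp
    | succ m =>
      rw [Nat.add_sub_cancel]
      push_cast
      field_simp
      ring

theorem natDegree_logDen (A : Finset ℂ) : (logDen A).natDegree = A.card := by
  rw [logDen, natDegree_prod_of_monic _ _ fun a _ => monic_X_sub_C a]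
  simp

theorem natDegree_X_mul_logNum_le (A : Finset ℂ) (α : ℂ → ℂ) :
    (X * logNum A α).natDegree ≤ A.card := by
  rw [logNum, Finset.mul_sum]
  refine natDegree_sum_le_of_forall_le _ _ fun a ha => ?_
  refine natDegree_mul_le.trans ?_
  have h1 : (C (α a) * logDen (A.erase a)).natDegree ≤ A.card - 1 :=
    (natDegree_C_mul_le _ _).trans (by rw [natDegree_logDen, Finset.card_erase_of_mem ha])
  have h2 : 0 < A.card := Finset.card_pos.2 ⟨a, ha⟩
  rw [natDegree_X]
  omega

theorem natDegree_X_pow_mul_derivative_le (p : ℂ[X]) (m : ℕ) :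
    (X ^ (m + 1) * derivative p).natDegree ≤ (X ^ m * p).natDegree := by
  by_cases h : derivative p = 0
  · simp [h]
  · have hp : p ≠ 0 := by rintro rfl; simp at h
    have hd : p.natDegree ≠ 0 := fun h0 => h (derivative_of_natDegree_zero h0)
    rw [natDegree_X_pow_mul _ h, natDegree_X_pow_mul _ hp]
    have := natDegree_derivative_lt hd
    omega

/-- Each term of the recursion for `derivNum` either differentiates once or multiplies by `logNum A
α`, losing one degree against `logDen A`. This is the source of vanishing to order `m` at infinity.
-/
theorem natDegree_derivNum_le (A : Finset ℂ) (α : ℂ → ℂ) (m : ℕ) :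
    (X ^ m * derivNum A α m).natDegree ≤ m * A.card := by
  induction m with
  | zero => simp [derivNum]
  | succ m ih =>
    have e : X ^ (m + 1) * derivNum A α (m + 1) =
        X ^ (m + 1) * derivative (derivNum A α m) * logDen A
        - C (m : ℂ) * ((X ^ 1 * derivative (logDen A)) * (X ^ m * derivNum A α m))
        + (X * logNum A α) * (X ^ m * derivNum A α m) := by
      rw [derivNum]; ring
    have h1 := natDegree_X_pow_mul_derivative_le (derivNum A α m) m
    have h2 := natDegree_X_pow_mul_derivative_le (logDen A) 0
    have h3 := natDegree_X_mul_logNum_le A α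
    rw [pow_zero, one_mul, natDegree_logDen, zero_add] at h2
    rw [e]
    have hc : (m + 1) * A.card = m * A.card + A.card := by ring
    refine (natDegree_add_le_of_le (m := (m + 1) * A.card) (n := (m + 1) * A.card)
      ((natDegree_sub_le_of_le (m := (m + 1) * A.card) (n := (m + 1) * A.card) ?_ ?_).trans
        (max_self _).le) ?_).trans (max_self _).le
    · refine natDegree_mul_le.trans ?_
      rw [natDegree_logDen]
      omega
    · refine (natDegree_C_mul_le _ _).trans (natDegree_mul_le.trans ?_)
      omega
    · refine natDegree_mul_le.trans ?_
      omega

theorem vanishLE_derivNum (A : Finset ℂ) (α : ℂ → ℂ) (m : ℕ) :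
    VanishLE m (quot (derivNum A α m) (logDen A ^ m)) := by
  have h0 : logDen A ≠ 0 := Finset.prod_ne_zero_iff.2 fun a _ => X_sub_C_ne_zero a
  refine ⟨_, _, pow_ne_zero _ h0, rfl, ?_⟩
  rw [natDegree_pow, natDegree_logDen]
  exact natDegree_derivNum_le A α m

end PoleOrder

/-! ### The coefficients of the shifted operator -/

namespace DiffOp

variable {n : ℕ} {P Q : DiffOp n} {b : ℂ} {A : Finset ℂ} {α : ℂ → ℂ} {u : ℂ → ℂ}

/-- The coefficient `q_k / q_n`, for `k ≤ n`. -/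
def normCoeff' (P : DiffOp n) (k : Fin (n + 1)) : RatFunc ℂ := P.coeff k / P.coeff (Fin.last n)

theorem normCoeff'_last (P : DiffOp n) : P.normCoeff' (Fin.last n) = 1 :=
  div_self P.lead_ne_zero

theorem hasValue_normCoeff' {t : ℂ} (ht : P.Nonsingular t) (k : Fin (n + 1)) :
    HasValue (P.normCoeff' k) t (ratVal (P.normCoeff' k) t) := by
  refine ⟨?_, rfl⟩
  induction k using Fin.lastCases with
  | last => rw [normCoeff'_last]; simp
  | cast i => exact ht i

theorem normApply_eq_sum (P : DiffOp n) (y : ℂ → ℂ) (t : ℂ) :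
    P.normApply y t = ∑ k : Fin (n + 1), ratVal (P.normCoeff' k) t * iteratedDeriv (k : ℕ) y t := by
  rw [Fin.sum_univ_castSucc, normCoeff'_last, add_comm]
  simp [normApply, ratVal_eq, normCoeff', normCoeff]

/-- The coefficients of the operator `u⁻¹ P u`. -/
def shiftCoeff (P : DiffOp n) (A : Finset ℂ) (α : ℂ → ℂ) (j : ℕ) : RatFunc ℂ :=
  ∑ k : Fin (n + 1), P.normCoeff' k * (((k : ℕ).choose j : ℕ) : RatFunc ℂ) *
    quot (derivNum A α (k - j)) (logDen A ^ ((k : ℕ) - j))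

theorem hasValue_shiftCoeff {t : ℂ} (ht : P.Nonsingular t) (htA : t ∉ A) (j : ℕ) :
    HasValue (P.shiftCoeff A α j) t (∑ k : Fin (n + 1), ratVal (P.normCoeff' k) t *
      ((k : ℕ).choose j : ℂ) *
        ((derivNum A α (k - j)).eval t / (logDen A ^ ((k : ℕ) - j)).eval t)) := by
  refine HasValue.sum _ fun k => ((hasValue_normCoeff' ht k).mul (HasValue.natCast _)).mul
    (hasValue_quot ?_)
  rw [Polynomial.eval_pow]
  exact pow_ne_zero _ (logDen_eval_ne_zero htA)

/-- The factor `q_k / q_n` contributes at most `n - k` to the pole order and the derivative quotient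
at most `k - j`, in total `n - j`. For `k < j` the binomial coefficient is zero, so truncated
subtraction is harmless. -/
theorem poleLE_shiftCoeff (hP : P.IsFuchsian) (a : ℂ) (j : ℕ) :
    PoleLE a (n - j) (P.shiftCoeff A α j) := by
  refine PoleLE.sum _ fun k => ?_
  by_cases hjk : j ≤ k
  · have h1 : PoleLE a (n - k) (P.normCoeff' k) := by
      induction k using Fin.lastCases with
      | last =>
        rw [normCoeff'_last]
        simpa using PoleLE.natCast (a := a) (m := n - (Fin.last n : ℕ)) 1
      | cast i => exact poleLE_iff.2 (hP.1 a i)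
    refine ((h1.mul (PoleLE.natCast (m := 0) _)).mul
      (poleLE_quot_logDen_pow a A _ _)).mono ?_
    have := k.is_le
    omega
  · rw [Nat.choose_eq_zero_of_lt (not_le.1 hjk), Nat.cast_zero, mul_zero, zero_mul]
    simpa using PoleLE.natCast (a := a) (m := n - j) 0

theorem vanishLE_shiftCoeff (hP : P.IsFuchsian) (j : ℕ) :
    VanishLE (n - j) (P.shiftCoeff A α j) := by
  refine VanishLE.sum _ fun k => ?_
  by_cases hjk : j ≤ k
  · have h1 : VanishLE (n - k) (P.normCoeff' k) := by
      induction k using Fin.lastCases with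
      | last =>
        rw [normCoeff'_last]
        simpa using VanishLE.natCast 1
      | cast i =>
        refine vanishLE_iff.2 ((hP.2 i).imp_right fun h => ?_)
        have := i.is_lt
        rw [Fin.val_castSucc]
        exact h.trans (by omega)
    have h2 := (h1.mul (VanishLE.natCast ((k : ℕ).choose j))).mul
      (vanishLE_derivNum A α (k - j))
    have e : n - (k : ℕ) + 0 + ((k : ℕ) - j) = n - j := by
      have := k.is_le
      omega
    rwa [e] at h2
  · rw [Nat.choose_eq_zero_of_lt (not_le.1 hjk), Nat.cast_zero, mul_zero, zero_mul]
    exact VanishLE.zero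

theorem shiftCoeff_last (P : DiffOp n) : P.shiftCoeff A α n = 1 := by
  rw [shiftCoeff, Finset.sum_eq_single (Fin.last n)]
  · simp [normCoeff'_last, quot, derivNum]
  · intro k _ hk
    rw [Nat.choose_eq_zero_of_lt, Nat.cast_zero, mul_zero, zero_mul]
    exact Fin.val_lt_last hk
  · simp

/-- If `u z` solves `P y = 0`, then `z` solves the equation with the coefficients `shiftCoeff`. -/
theorem sum_shiftCoeff_eq_zero (hP : P.Nonsingular b) (hu : HasLogDeriv u b A α) {z : ℂ → ℂ}
    (hz : AnalyticAt ℂ z b) (hzu : P.IsSol (z * u) b) :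
    ∀ᶠ t in 𝓝 b, iteratedDeriv n z t +
      ∑ j : Fin n, ratVal (P.shiftCoeff A α j) t * iteratedDeriv (j : ℕ) z t = 0 := by
  have hall : ∀ᶠ t in 𝓝 b, ∀ m : Fin (n + 1), iteratedDeriv (m : ℕ) u t =
      (derivNum A α m).eval t / (logDen A ^ (m : ℕ)).eval t * u t :=
    eventually_all.2 fun m => hu.iteratedDeriv_eq m
  filter_upwards [hall, hzu.2, hz.eventually_analyticAt, hu.analyticAt.eventually_analyticAt,
    hu.analyticAt.continuousAt.eventually_ne hu.ne_zero,
    eventually_notMem_finset hu.notMem, P.isOpen_nonsingular.mem_nhds hP]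
    with t h1 h2 h3 h4 h5 h6 h7
  have hleib : ∀ k : Fin (n + 1), iteratedDeriv (k : ℕ) (z * u) t =
      ∑ j : Fin (n + 1), ((k : ℕ).choose j : ℂ) * iteratedDeriv (j : ℕ) z t *
        ((derivNum A α (k - j)).eval t / (logDen A ^ ((k : ℕ) - j)).eval t) * u t := by
    intro k
    rw [iteratedDeriv_mul h3.contDiffAt h4.contDiffAt]
    -- The Leibniz sum is padded to all `j ≤ n`, a range independent of `k`, so that the double sum
    -- can be interchanged; the added binomials vanish.
    rw [Finset.sum_subset (Finset.range_mono (Nat.succ_le_succ k.is_le)),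
      Finset.sum_range]
    · refine Finset.sum_congr rfl fun j _ => ?_
      have := h1 ⟨(k : ℕ) - j, by omega⟩
      simp only at this
      rw [this]
      ring
    · intro j _ hj
      rw [Nat.choose_eq_zero_of_lt (by simpa [Nat.succ_le_iff] using hj)]
      simp
  have hsum : (∑ j : Fin (n + 1), ratVal (P.shiftCoeff A α j) t * iteratedDeriv (j : ℕ) z t) *
      u t = 0 := by
    rw [← h2, normApply_eq_sum, Finset.sum_mul]
    simp only [hleib, Finset.mul_sum]
    rw [Finset.sum_comm]
    refine Finset.sum_congr rfl fun j _ => ?_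
    rw [(hasValue_shiftCoeff h7 h6 j).2, Finset.sum_mul, Finset.sum_mul]
    exact Finset.sum_congr rfl fun k _ => by ring
  have h0 := (mul_eq_zero.1 hsum).resolve_right h5
  rw [Fin.sum_univ_castSucc, add_comm] at h0
  simpa [shiftCoeff_last, ratVal_eq] using h0

/-- Solutions of `Q` with the standard basis as jets at `b` have an invertible Wronskian matrix near
`b`. Both monic operators annihilate them, so their coefficients agree there as functions, hence as
rational functions. -/
theorem normCoeff_eq_shiftCoeff (hn : 0 < n) (hP : P.Nonsingular b) (hQ : Q.Nonsingular b)
    (hu : HasLogDeriv u b A α) (h : Q.IsShift P b u) (j : Fin n) :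
    Q.normCoeff j = P.shiftCoeff A α j := by
  obtain ⟨ρ, hρ, -, hsol⟩ := Q.exists_ball_solution hn hQ
  choose z hz hjet using fun i : Fin n =>
    hsol b (Metric.mem_ball_self hρ) (Pi.single i (1 : ℂ))
  have hzb : ∀ i, Q.IsSol (z i) b := fun i => hz i b (Metric.mem_ball_self hρ)
  have hzu : ∀ i, P.IsSol (z i * u) b := fun i => by
    have := h _ (mem_solutions_iff.2 (hzb i))
    rw [mul_comm] at this
    exact mem_solutions_iff.1 this
  let Z : ℂ → Matrix (Fin n) (Fin n) ℂ := fun t => Matrix.of fun k i => iteratedDeriv (k : ℕ) (z i) t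
  have hZb : (Z b).det = 1 := by
    have : Z b = 1 := by
      ext k i
      have h1 : Z b k i = (Pi.single i (1 : ℂ) : Fin n → ℂ) k := congrFun (hjet i) k
      rw [h1, Matrix.one_apply, Pi.single_apply]
    rw [this, Matrix.det_one]
  have hZc : ContinuousAt (fun t => (Z t).det) b := by
    refine Continuous.continuousAt (f := Matrix.det) (by fun_prop) |>.comp ?_
    exact continuousAt_pi.2 fun k => continuousAt_pi.2 fun i =>
      (analyticAt_iteratedDeriv (hzb i).1 k).continuousAt
  have key : ∀ᶠ t in 𝓝 b, ∀ j, ratVal (Q.normCoeff j) t = ratVal (P.shiftCoeff A α j) t := by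
    filter_upwards [eventually_all.2 fun i => (hzb i).2,
      eventually_all.2 fun i => sum_shiftCoeff_eq_zero hP hu (hzb i).1 (hzu i),
      hZc.eventually_ne (by rw [hZb]; exact one_ne_zero)] with t h1 h2 h3 j
    have hv : Matrix.vecMul (fun j => ratVal (Q.normCoeff j) t - ratVal (P.shiftCoeff A α j) t)
        (Z t) = 0 := by
      funext i
      have e1 := h1 i
      have e2 := h2 i
      rw [normApply] at e1
      simp only [Matrix.vecMul, dotProduct, Z, Matrix.of_apply, sub_mul, Finset.sum_sub_distrib,
        Pi.zero_apply]
      linear_combination e1 - e2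
    exact sub_eq_zero.1 (congrFun (Matrix.eq_zero_of_vecMul_eq_zero h3 hv) j)
  exact eq_of_eventually_ratVal_eq (hQ j) (hasValue_shiftCoeff hP hu.notMem j).1
    (key.mono fun t ht => ht j)

/-- A shift of a Fuchsian operator is Fuchsian. -/
theorem IsFuchsian.of_isShift (hn : 0 < n) (hP : P.Nonsingular b) (hQ : Q.Nonsingular b)
    (hu : HasLogDeriv u b A α) (h : Q.IsShift P b u) (hF : P.IsFuchsian) : Q.IsFuchsian := by
  refine ⟨fun a i => ?_, fun i => ?_⟩
  · rw [normCoeff_eq_shiftCoeff hn hP hQ hu h]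
    exact poleLE_iff.1 (poleLE_shiftCoeff hF a i)
  · rw [normCoeff_eq_shiftCoeff hn hP hQ hu h]
    refine (vanishLE_iff.1 (vanishLE_shiftCoeff hF i)).imp_right fun h => h.trans ?_
    have := i.is_lt
    omega

end DiffOp

end FuchsianShift

end

/-! ### The main theorem. -/

theorem mainTheorem6 (P Q : FuchsianShift.DiffOp 4) (b : ℂ)
    (hP : P.Nonsingular b) (hQ : Q.Nonsingular b)
    (f : ℂ → ℂ) (hf : AnalyticAt ℂ f b) (hfb : f b ≠ 0)
    (hroot : ∃ n : ℕ, 1 ≤ n ∧ FuchsianShift.IsRationalAt b (fun t => f t ^ n))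
    (hsymp : P.IsSymplectic hP) (hshift : P.IsShift Q b f) :
    (FuchsianShift.IsRationalAt b (fun t => f t ^ 2) →
      Q.IsSymplectic hQ ∧ (P.HasArithmeticMonodromy hP ↔ Q.HasArithmeticMonodromy hQ)) ∧
    (Q.IsSymplectic hQ →
      (∃ (e : Module.Basis (Fin 2 ⊕ Fin 2) ℂ (P.solutions b))
        (e' : Module.Basis (Fin 2 ⊕ Fin 2) ℂ (Q.solutions b)),
        FuchsianShift.IsZariskiDenseInSp4Z
          (P.monodromyMatrices hP e ⊓ Q.monodromyMatrices hQ e')) →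
      FuchsianShift.IsRationalAt b (fun t => f t ^ 2)) := by
  obtain ⟨n, hn, hr⟩ := hroot
  obtain ⟨hF, e, he⟩ := hsymp
  have hdim : Module.finrank ℂ (P.solutions b) = 4 := by
    rw [Module.finrank_eq_card_basis e]; rfl
  obtain ⟨φ, hφ⟩ := hshift.exists_equiv (by norm_num) hQ hf hfb hdim
  refine ⟨fun hsq => ⟨⟨?_, e.map φ, ?_⟩, ?_, ?_⟩, fun hQs _ => ?_⟩
  · obtain ⟨r, hr⟩ := hr
    obtain ⟨A, α, hA, -⟩ := FuchsianShift.exists_hasLogDeriv hf hfb hn hr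
    -- The transfer of coefficients needs solutions of `P` in terms of those of `Q`, hence the
    -- inverse shift by `f⁻¹`.
    refine FuchsianShift.DiffOp.IsFuchsian.of_isShift (by norm_num) hP hQ hA.inv (fun z hz => ?_) hF
    rw [← hφ.symm hf hfb ⟨z, hz⟩]
    exact (φ.symm ⟨z, hz⟩).2
  · obtain ⟨h, h'⟩ := FuchsianShift.leUpToSign_of_sq_rational hφ hP hQ hf hfb hsq e
    exact he.of_leUpToSign h h'
  · rintro ⟨e₁, he₁⟩
    obtain ⟨h, h'⟩ := FuchsianShift.leUpToSign_of_sq_rational hφ hP hQ hf hfb hsq e₁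
    exact ⟨e₁.map φ, he₁.of_leUpToSign h h'⟩
  · rintro ⟨e₁, he₁⟩
    obtain ⟨h, h'⟩ := FuchsianShift.leUpToSign_of_sq_rational hφ hP hQ hf hfb hsq (e₁.map φ.symm)
    have hmap : (e₁.map φ.symm).map φ = e₁ := by ext i; simp
    rw [hmap] at h h'
    exact ⟨e₁.map φ.symm, he₁.of_leUpToSign h' h⟩
  · obtain ⟨-, e', he'⟩ := hQs
    exact FuchsianShift.isRationalAt_sq_of_dense hφ hf hfb hn hr he he'.1
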